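/- Let $J$ be a (small) set of maps in a locally finitely presentable category $\mathcal C$, let $\mathcal R$ be the class of maps with the right lifting property against $J$, and let $\mathcal L$ be the class of maps with the left lifting property against $\mathcal R$. *Algebraic realisations.* An algebraic realisation of $(\mathcal L,\mathcal R)$ consists of a functorial factorisation $f=\rho_f\lambda_f$, $X\xrightarrow{\lambda_f}Pf\xrightarrow{\rho_f}Y$, of the maps of $\mathcal C$ with $\lambda_f\in\mathcal L$, $\rho_f\in\mathcal R$, and maps $\sigma_f\colon Pf\to P\lambda_f$ and $\pi_f\colon P\rho_f\to Pf$, natural in $f$, such that $f\mapsto\lambda_f$ is a comonad $\mathsf L$ on the arrow category with counit $(1,\rho_f)$ and comultiplication $(1,\sigma_f)$, $f\mapsto\rho_f$ is a monad $\mathsf R$ with unit $(\lambda_f,1)$ and multiplication $(\pi_f,1)$, and $(\sigma_f,\pi_f)\colon\lambda_{\rho_f}\to\rho_{\lambda_f}$ is a distributive law of $\mathsf L$ over $\mathsf R$. The same data without the conditions $\lambda_f\in\mathcal L$, $\rho_f\in\mathcal R$ is a natural weak factorisation system (n.w.f.s.); a morphism of such is a natural family $\alpha_f\colon Pf\to P'f$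 commuting with $\lambda,\rho$ and inducing a morphism of comonads $\mathsf L\to\mathsf L'$ and a morphism of monads $\mathsf R\to\mathsf R'$. An algebraic realisation with a chosen $\mathsf L$-coalgebra structure $(1,s_j)\colon j\to\lambda_j$ on each $j\in J$ is *universal* if for each n.w.f.s. $(\mathsf L',\mathsf R')$ with chosen $\mathsf L'$-coalgebra structures on the maps $j\in J$ there is exactly one morphism $(\mathsf L,\mathsf R)\to(\mathsf L',\mathsf R')$ preserving the chosen coalgebra structures. The *universal cofibrant replacement comonad* $(Q,\epsilon,\Delta)$ is the restriction of $\mathsf L$ to the coslice $0/\mathcal C\cong\mathcal C$; so $QX=P(0\to X)$, $\epsilon_X=\rho_{0\to X}$, and $\Delta_X=\sigma_{0\to X}\colon QX\to QQX$. *Algebraic acyclic fibrations.* A choice of liftings for $f\colon Y\to X$ is a function $\phi$ assigning to each $j\colon A\to B$ in $J$ and each $h\colon A\to Y$, $k\colon B\to X$ with $fh=kj$ a map $\phi(j,h,k)\colon B\to Y$ with $\phi(j,h,k)\,j=h$ and $f\,\phi(j,h,k)=k$. The category $\mathbf{AAF}/X$ has as objects the pairs $(f,\phi)$ of a map $f$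 into $X$ and a choice of liftings for it, and as morphisms $(f,\phi)\to(g,\psi)$ the maps $u$ with $gu=f$ and $u\,\phi(j,h,k)=\psi(j,uh,k)$ for all $(j,h,k)$. If $f\colon C\to D$ and $g\colon D\to E$ have choices of liftings $\phi$ and $\psi$, then $gf$ has the composite choice of liftings $(\phi\bullet\psi)(j,h,k)=\phi(j,h,\psi(j,fh,k))$. Let $\phi_X$ be the choice of liftings for $\epsilon_X$ given by $\phi_X(j,h,k)=\pi_f\circ P(h,k)\circ s_j$, where $f\colon 0\to X$ is the unique map. **Proposition.** A universal algebraic realisation of $(\mathcal L,\mathcal R)$ exists. For every universal algebraic realisation and every $X\in\mathcal C$, the object $(\epsilon_X,\phi_X)$ of $\mathbf{AAF}/X$ is initial, and the unique map in $\mathbf{AAF}/X$ from $(\epsilon_X,\phi_X)$ to $(\epsilon_X\cdot\epsilon_{QX},\ \phi_{QX}\bullet\phi_X)$ is the comultiplication $\Delta_X\colon QX\to QQX$ of the universal cofibrant replacement comonad. -/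

import Mathlib

open CategoryTheory Limits

universe v u

namespace AlgFact

section Realisation

variable {C : Type u} [Category.{v} C]

/-- An algebraic realisation of the pair `(W₁, W₂)` of classes of maps: a functorial factorisation
`f = lam f ≫ rho f` through `P f`, with `lam f ∈ W₁` and `rho f ∈ W₂`, together with fillers
`sigma f : P f ⟶ P (lam f)` and `pi f : P (rho f) ⟶ P f`, such that

* `f ↦ lam f` is a comonad on the arrow category, with counit `(1, rho f)` and comultiplication
  `(1, sigma f)`;
* `f ↦ rho f` is a monad on the arrow category, with unit `(lam f, 1)` and multiplication
  `(pi f, 1)`;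
* `(sigma f, pi f) : lam (rho f) ⟶ rho (lam f)` is a distributive law of the comonad over the
  monad. Of its four axioms, the two that involve the unit and the counit follow from the other
  fields, and each of the other two amounts to (co)associativity together with the single
  equation `distrib`. -/
structure Realisation (W₁ W₂ : MorphismProperty C) where
  P : ∀ {X Y : C}, (X ⟶ Y) → C
  /-- `P(h, k) : P f ⟶ P g`, for a commutative square `(h, k) : f ⟶ g` -/
  map : ∀ {X Y X' Y' : C} {f : X ⟶ Y} {g : X' ⟶ Y'} (h : X ⟶ X') (k : Y ⟶ Y'),
    h ≫ g = f ≫ k → (P f ⟶ P g)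
  lam : ∀ {X Y : C} (f : X ⟶ Y), X ⟶ P f
  rho : ∀ {X Y : C} (f : X ⟶ Y), P f ⟶ Y
  sigma : ∀ {X Y : C} (f : X ⟶ Y), P f ⟶ P (lam f)
  pi : ∀ {X Y : C} (f : X ⟶ Y), P (rho f) ⟶ P f
  -- a factorisation into a map of `W₁` and a map of `W₂`
  fac : ∀ {X Y : C} (f : X ⟶ Y), lam f ≫ rho f = f
  lam_mem : ∀ {X Y : C} (f : X ⟶ Y), W₁ (lam f)
  rho_mem : ∀ {X Y : C} (f : X ⟶ Y), W₂ (rho f)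
  -- the chosen maps are fillers
  lam_map : ∀ {X Y X' Y' : C} {f : X ⟶ Y} {g : X' ⟶ Y'} (h : X ⟶ X') (k : Y ⟶ Y')
    (w : h ≫ g = f ≫ k), lam f ≫ map h k w = h ≫ lam g
  map_rho : ∀ {X Y X' Y' : C} {f : X ⟶ Y} {g : X' ⟶ Y'} (h : X ⟶ X') (k : Y ⟶ Y')
    (w : h ≫ g = f ≫ k), map h k w ≫ rho g = rho f ≫ k
  lam_sigma : ∀ {X Y : C} (f : X ⟶ Y), lam f ≫ sigma f = lam (lam f)
  sigma_rho : ∀ {X Y : C} (f : X ⟶ Y), sigma f ≫ rho (lam f) = 𝟙 (P f)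
  lam_pi : ∀ {X Y : C} (f : X ⟶ Y), lam (rho f) ≫ pi f = 𝟙 (P f)
  pi_rho : ∀ {X Y : C} (f : X ⟶ Y), pi f ≫ rho f = rho (rho f)
  -- functoriality and naturality
  map_id : ∀ {X Y : C} (f : X ⟶ Y) (w : 𝟙 X ≫ f = f ≫ 𝟙 Y), map (𝟙 X) (𝟙 Y) w = 𝟙 (P f)
  map_comp : ∀ {X Y X' Y' X'' Y'' : C} {f : X ⟶ Y} {g : X' ⟶ Y'} {l : X'' ⟶ Y''}
    (h : X ⟶ X') (k : Y ⟶ Y') (h' : X' ⟶ X'') (k' : Y' ⟶ Y'')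
    (w : h ≫ g = f ≫ k) (w' : h' ≫ l = g ≫ k') (w'' : (h ≫ h') ≫ l = f ≫ k ≫ k'),
    map (h ≫ h') (k ≫ k') w'' = map h k w ≫ map h' k' w'
  sigma_naturality : ∀ {X Y X' Y' : C} {f : X ⟶ Y} {g : X' ⟶ Y'} (h : X ⟶ X') (k : Y ⟶ Y')
    (w : h ≫ g = f ≫ k),
    map h k w ≫ sigma g = sigma f ≫ map h (map h k w) (lam_map h k w).symm
  pi_naturality : ∀ {X Y X' Y' : C} {f : X ⟶ Y} {g : X' ⟶ Y'} (h : X ⟶ X') (k : Y ⟶ Y')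
    (w : h ≫ g = f ≫ k),
    pi f ≫ map h k w = map (map h k w) k (map_rho h k w) ≫ pi g
  -- the remaining comonad laws: `P(1, ρ_f) ∘ σ_f = 1` and `P(1, σ_f) ∘ σ_f = σ_{λ_f} ∘ σ_f`
  sigma_counit : ∀ {X Y : C} (f : X ⟶ Y),
    sigma f ≫ map (𝟙 X) (rho f) ((Category.id_comp f).trans (fac f).symm) = 𝟙 (P f)
  sigma_coassoc : ∀ {X Y : C} (f : X ⟶ Y),
    sigma f ≫ map (𝟙 X) (sigma f) ((Category.id_comp _).trans (lam_sigma f).symm) =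
      sigma f ≫ sigma (lam f)
  -- the remaining monad laws: `π_f ∘ P(λ_f, 1) = 1` and `π_f ∘ P(π_f, 1) = π_f ∘ π_{ρ_f}`
  pi_unit : ∀ {X Y : C} (f : X ⟶ Y),
    map (lam f) (𝟙 Y) ((fac f).trans (Category.comp_id f).symm) ≫ pi f = 𝟙 (P f)
  pi_assoc : ∀ {X Y : C} (f : X ⟶ Y),
    map (pi f) (𝟙 Y) ((pi_rho f).trans (Category.comp_id _).symm) ≫ pi f =
      pi (rho f) ≫ pi f
  -- the distributive law: `σ_f ∘ π_f = π_{λ_f} ∘ P(σ_f, π_f) ∘ σ_{ρ_f}`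
  distrib : ∀ {X Y : C} (f : X ⟶ Y),
    pi f ≫ sigma f =
      sigma (rho f) ≫ map (sigma f) (pi f) ((sigma_rho f).trans (lam_pi f).symm) ≫ pi (lam f)

/-- A natural weak factorisation system, with no constraint on the underlying classes of maps. -/
abbrev NWFS (C : Type u) [Category.{v} C] :=
  Realisation (⊤ : MorphismProperty C) (⊤ : MorphismProperty C)

namespace Realisation

variable {W₁ W₂ W₁' W₂' : MorphismProperty C}

/-- A structure of coalgebra for the comonad `f ↦ lam f` on a map `f`; by the counit law it is
necessarily of the form `(1, s) : f ⟶ lam f`. -/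
structure CoalgStr (N : Realisation W₁ W₂) {A B : C} (f : A ⟶ B) where
  s : B ⟶ N.P f
  hom_s : f ≫ s = N.lam f
  s_counit : s ≫ N.rho f = 𝟙 B
  s_coassoc : s ≫ N.map (𝟙 A) s ((Category.id_comp _).trans hom_s.symm) = s ≫ N.sigma f

/-- A morphism of natural weak factorisation systems: a morphism `α` of functorial factorisations
such that the maps `(1, α_f) : lam f ⟶ lam' f` form a morphism of comonads and the maps
`(α_f, 1) : rho f ⟶ rho' f` form a morphism of monads. -/
structure Hom (N : Realisation W₁ W₂) (N' : Realisation W₁' W₂') where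
  app : ∀ {X Y : C} (f : X ⟶ Y), N.P f ⟶ N'.P f
  naturality : ∀ {X Y X' Y' : C} {f : X ⟶ Y} {g : X' ⟶ Y'} (h : X ⟶ X') (k : Y ⟶ Y')
    (w : h ≫ g = f ≫ k), N.map h k w ≫ app g = app f ≫ N'.map h k w
  lam_app : ∀ {X Y : C} (f : X ⟶ Y), N.lam f ≫ app f = N'.lam f
  app_rho : ∀ {X Y : C} (f : X ⟶ Y), app f ≫ N'.rho f = N.rho f
  sigma_app : ∀ {X Y : C} (f : X ⟶ Y),
    N.sigma f ≫ app (N.lam f) ≫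
        N'.map (𝟙 X) (app f) ((Category.id_comp _).trans (lam_app f).symm) =
      app f ≫ N'.sigma f
  pi_app : ∀ {X Y : C} (f : X ⟶ Y),
    N.pi f ≫ app f =
      app (N.rho f) ≫
        N'.map (app f) (𝟙 Y) ((app_rho f).trans (Category.comp_id _).symm) ≫ N'.pi f

/-- A choice of a distinguished coalgebra structure on each map of `J`. -/
abbrev Coalgs (N : Realisation W₁ W₂) (J : MorphismProperty C) :=
  ∀ ⦃A B : C⦄ (j : A ⟶ B), J j → N.CoalgStr j

/-- `N` is freely generated, as a natural weak factorisation system, by the distinguished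
coalgebra structures `s` on the maps of `J`: for every natural weak factorisation system with a
coalgebra structure on each map of `J`, there is a unique morphism from `N` to it which preserves
the distinguished coalgebras. -/
def IsUniversal {J : MorphismProperty C} (N : Realisation W₁ W₂) (s : N.Coalgs J) : Prop :=
  ∀ (N' : NWFS C) (s' : N'.Coalgs J), ∃! m : N.Hom N',
    ∀ ⦃A B : C⦄ (j : A ⟶ B) (hj : J j), (s j hj).s ≫ m.app j = (s' j hj).s

end Realisation

end Realisation

section AAF

variable {C : Type u} [Category.{v} C]

/-- A choice of liftings for `f : Y ⟶ X` with respect to the maps of `J`. -/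
@[ext]
structure Liftings (J : MorphismProperty C) {Y X : C} (f : Y ⟶ X) where
  lift : ∀ ⦃A B : C⦄ (j : A ⟶ B), J j → ∀ (h : A ⟶ Y) (k : B ⟶ X), h ≫ f = j ≫ k → (B ⟶ Y)
  fac_left : ∀ ⦃A B : C⦄ (j : A ⟶ B) (hj : J j) (h : A ⟶ Y) (k : B ⟶ X) (w : h ≫ f = j ≫ k),
    j ≫ lift j hj h k w = h
  fac_right : ∀ ⦃A B : C⦄ (j : A ⟶ B) (hj : J j) (h : A ⟶ Y) (k : B ⟶ X) (w : h ≫ f = j ≫ k),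
    lift j hj h k w ≫ f = k

/-- The induced choice of liftings for a composite `f ≫ g`:
`(j, h, k) ↦ φ (j, h, ψ (j, h ≫ f, k))`. -/
def Liftings.comp {J : MorphismProperty C} {Y X W : C} {f : Y ⟶ X} {g : X ⟶ W}
    (φ : Liftings J f) (ψ : Liftings J g) : Liftings J (f ≫ g) where
  lift _ _ j hj h k w :=
    φ.lift j hj h
      (ψ.lift j hj (h ≫ f) k ((Category.assoc _ _ _).trans w)) (ψ.fac_left _ _ _ _ _).symm
  fac_left _ _ _ _ _ _ _ := φ.fac_left _ _ _ _ _
  fac_right _ _ j hj h k w := by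
    rw [← Category.assoc, φ.fac_right, ψ.fac_right]

/-- The algebraic acyclic fibrations into `X`. -/
structure AAF (J : MorphismProperty C) (X : C) where
  {dom : C}
  map : dom ⟶ X
  φ : Liftings J map

/-- The morphisms of `AAF/X`: maps over `X` preserving the chosen liftings. -/
@[ext]
structure AAF.Hom {J : MorphismProperty C} {X : C} (F G : AAF J X) where
  hom : F.dom ⟶ G.dom
  w : hom ≫ G.map = F.map
  lift_hom : ∀ ⦃A B : C⦄ (j : A ⟶ B) (hj : J j) (h : A ⟶ F.dom) (k : B ⟶ X)
    (e : h ≫ F.map = j ≫ k),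
    F.φ.lift j hj h k e ≫ hom = G.φ.lift j hj (h ≫ hom) k (by rw [Category.assoc, w, e])

/-- The category `AAF/X`. -/
instance (J : MorphismProperty C) (X : C) : Category (AAF J X) where
  Hom F G := AAF.Hom F G
  id F := ⟨𝟙 _, Category.id_comp _, fun _ _ j hj h k e => by simp⟩
  comp u v := ⟨u.hom ≫ v.hom, by rw [Category.assoc, v.w, u.w], fun _ _ j hj h k e => by
    rw [← Category.assoc, u.lift_hom, v.lift_hom]; simp⟩
  id_comp u := AAF.Hom.ext (Category.id_comp _)
  comp_id u := AAF.Hom.ext (Category.comp_id _)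
  assoc u v w := AAF.Hom.ext (Category.assoc _ _ _)

end AAF

section CofibrantReplacement

variable {C : Type u} [Category.{v} C] {W₁ W₂ : MorphismProperty C}

namespace Realisation

variable (N : Realisation W₁ W₂)

/-- The choice of liftings for `rho f` determined by distinguished coalgebra structures on the
maps of `J` and by the free algebra structure `pi f` on `rho f`: the lifting for `(j, h, k)` is
the composite `B ⟶ P j ⟶ P (rho f) ⟶ P f` of the coalgebra structure of `j`, `P(h, k)` and
`pi f`. -/
def freeLiftings {J : MorphismProperty C} (s : N.Coalgs J) {X Y : C} (f : X ⟶ Y) :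
    Liftings J (N.rho f) where
  lift _ _ j hj h k w := (s j hj).s ≫ N.map h k w ≫ N.pi f
  fac_left A B j hj h k w := by
    rw [← Category.assoc, (s j hj).hom_s, ← Category.assoc, N.lam_map, Category.assoc, N.lam_pi,
      Category.comp_id]
  fac_right A B j hj h k w := by
    rw [Category.assoc, Category.assoc, N.pi_rho, N.map_rho, ← Category.assoc, (s j hj).s_counit,
      Category.id_comp]

variable [HasInitial C]

/-- `P(1, g) : P f ⟶ P f'` for maps `f` and `f'` out of the initial object. -/
noncomputable def mapBot {Y Y' : C} (f : ⊥_ C ⟶ Y) (f' : ⊥_ C ⟶ Y') (g : Y ⟶ Y') :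
    N.P f ⟶ N.P f' :=
  N.map (𝟙 _) g (initial.hom_ext _ _)

lemma mapBot_id {Y : C} (f : ⊥_ C ⟶ Y) : N.mapBot f f (𝟙 Y) = 𝟙 (N.P f) :=
  N.map_id _ _

lemma mapBot_comp {Y Y' Y'' : C} (f : ⊥_ C ⟶ Y) (f' : ⊥_ C ⟶ Y') (f'' : ⊥_ C ⟶ Y'')
    (g : Y ⟶ Y') (g' : Y' ⟶ Y'') :
    N.mapBot f f' g ≫ N.mapBot f' f'' g' = N.mapBot f f'' (g ≫ g') := by
  unfold mapBot
  rw [← N.map_comp (w'' := initial.hom_ext _ _)]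
  congr 1
  exact Category.comp_id _

lemma mapBot_rho {Y Y' : C} (f : ⊥_ C ⟶ Y) (f' : ⊥_ C ⟶ Y') (g : Y ⟶ Y') :
    N.mapBot f f' g ≫ N.rho f' = N.rho f ≫ g :=
  N.map_rho _ _ _

lemma mapBot_sigma {Y Y' : C} (f : ⊥_ C ⟶ Y) (f' : ⊥_ C ⟶ Y') (g : Y ⟶ Y') :
    N.mapBot f f' g ≫ N.sigma f' =
      N.sigma f ≫ N.mapBot (N.lam f) (N.lam f') (N.mapBot f f' g) :=
  N.sigma_naturality _ _ _

lemma sigma_mapBot_rho {Y : C} (f : ⊥_ C ⟶ Y) :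
    N.sigma f ≫ N.mapBot (N.lam f) f (N.rho f) = 𝟙 (N.P f) :=
  N.sigma_counit f

lemma sigma_mapBot_sigma {Y : C} (f : ⊥_ C ⟶ Y) :
    N.sigma f ≫ N.mapBot (N.lam f) (N.lam (N.lam f)) (N.sigma f) =
      N.sigma f ≫ N.sigma (N.lam f) :=
  N.sigma_coassoc f

/-- The restriction of the comonad `f ↦ lam f` to the coslice category `0 / C`, identified with
`C`. It sends `X` to `Q X = P (0 ⟶ X)`, its counit is `rho (0 ⟶ X)`, and its comultiplication is
`sigma (0 ⟶ X)`, followed by the identification of `P (lam (0 ⟶ X))` with `P (0 ⟶ Q X)`. -/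
noncomputable def cofibrantReplacement : Comonad C where
  obj X := N.P (initial.to X)
  map g := N.mapBot _ _ g
  map_id X := N.mapBot_id _
  map_comp g g' := (N.mapBot_comp _ _ _ g g').symm
  ε :=
    { app := fun X => N.rho (initial.to X)
      naturality := fun _ _ g => N.mapBot_rho _ _ g }
  δ :=
    { app := fun X => N.sigma (initial.to X) ≫ N.mapBot (N.lam (initial.to X)) (initial.to _) (𝟙 _)
      naturality := fun X Y g => by
        change N.mapBot _ _ g ≫ N.sigma _ ≫ N.mapBot _ _ _ =
          (N.sigma _ ≫ N.mapBot _ _ _) ≫ N.mapBot _ _ (N.mapBot _ _ g)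
        rw [← Category.assoc, N.mapBot_sigma, Category.assoc, Category.assoc, N.mapBot_comp,
          N.mapBot_comp, Category.comp_id, Category.id_comp] }
  coassoc X := by
    change (N.sigma _ ≫ N.mapBot _ _ _) ≫ N.mapBot _ _ (N.sigma _ ≫ N.mapBot _ _ _) =
      (N.sigma _ ≫ N.mapBot _ _ _) ≫ N.sigma _ ≫ N.mapBot _ _ _
    rw [Category.assoc, Category.assoc, N.mapBot_comp, ← Category.assoc (N.mapBot _ _ _) (N.sigma _),
      N.mapBot_sigma, Category.assoc, N.mapBot_comp, ← Category.assoc (N.sigma _) (N.sigma _),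
      ← N.sigma_mapBot_sigma, Category.assoc, N.mapBot_comp, Category.id_comp, Category.comp_id]
  left_counit X := by
    change (N.sigma _ ≫ N.mapBot _ _ _) ≫ N.rho _ = 𝟙 _
    rw [Category.assoc, N.mapBot_rho, Category.comp_id, N.sigma_rho]
  right_counit X := by
    change (N.sigma _ ≫ N.mapBot _ _ _) ≫ N.mapBot _ _ (N.rho _) = 𝟙 _
    rw [Category.assoc, N.mapBot_comp, Category.id_comp, N.sigma_mapBot_rho]

/-- The algebraic acyclic fibration `(ε_X, φ_X)`. -/
noncomputable def counitAAF {J : MorphismProperty C} (s : N.Coalgs J) (X : C) : AAF J X where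
  dom := N.cofibrantReplacement.obj X
  map := N.cofibrantReplacement.ε.app X
  φ := N.freeLiftings s (initial.to X)

/-- The algebraic acyclic fibration given by the composite of `ε_{QX} : QQX ⟶ QX` and
`ε_X : QX ⟶ X`, with the composite of the choices of liftings `φ_{QX}` and `φ_X`. -/
noncomputable def counitCompAAF {J : MorphismProperty C} (s : N.Coalgs J) (X : C) : AAF J X where
  dom := N.cofibrantReplacement.obj (N.cofibrantReplacement.obj X)
  map := N.cofibrantReplacement.ε.app (N.cofibrantReplacement.obj X) ≫
    N.cofibrantReplacement.ε.app X
  φ := (N.counitAAF s (N.cofibrantReplacement.obj X)).φ.comp (N.counitAAF s X).φ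

end Realisation

end CofibrantReplacement

/-- A locally finitely presentable category has an initial object. -/
instance hasInitial_of_lfp (C : Type u) [Category.{v} C] [IsLocallyFinitelyPresentable.{v} C] :
    HasInitial C := by
  have : Fact Cardinal.aleph0.{v}.IsRegular := Cardinal.fact_isRegular_aleph0
  have : HasColimitsOfSize.{v, v} C :=
    IsCardinalLocallyPresentable.toHasColimitsOfSize Cardinal.aleph0.{v}
  infer_instance

end AlgFact

/-! Everything rests on free factorisations. For `f : X ⟶ Y`, write `f = lam ≫ rho` with a choice of
liftings on `rho` such that every square from `f` to a map with liftings extends uniquely along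
`lam` to a square from `rho` that respects liftings (`FreeFactorisation`).

Existence: attaching a cell for every square, and iterating transfinitely, gives an algebraic
acyclic fibration under `X` that is only weakly initial, since its liftings see only the cells at
chosen stages. Equalising all its endomorphisms under `X` makes it initial, as in Freyd's initial
object theorem (`exists_free_factorisation`). Pulling back along maps `Y ⟶ W` extends freeness to
all squares.

Given free factorisations, `P(h, k)`, `sigma` and `pi` are the extensions of evident squares, `sigma
f` mapping into the composite of `rho (lam f)` and `rho f`. Each axiom equates two maps that respect
liftings and agree on `lam`, so `hom_ext` proves it.

Conversely, in any natural weak factorisation system with coalgebras on `J`, each `rho f` has its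
free liftings. They are respected by `P(h, k)`, by `pi` through associativity, and by `sigma`
through the distributive law. Freeness thus gives a unique comparison morphism, so the free
realisation is universal. Every universal realisation is isomorphic to it and so has free
factorisations; at `0 ⟶ X` freeness is initiality. Since the comultiplication respects liftings, it
is the unique map. -/

namespace AlgFact

/-! ### Completeness and presentability ranks in locally finitely presentable categories -/

section Limits

/-- A locally finitely presentable category is complete: it is reflective in the presheaves on
its finitely presentable objects. -/
instance hasLimits_of_lfp (C : Type u) [Category.{v} C] [IsLocallyFinitelyPresentable.{v} C] :
    HasLimits C := by
  have : Fact Cardinal.aleph0.{v}.IsRegular := Cardinal.fact_isRegular_aleph0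
  have : HasColimitsOfSize.{v, v} C :=
    IsCardinalLocallyPresentable.toHasColimitsOfSize Cardinal.aleph0.{v}
  let P := isCardinalPresentable C Cardinal.aleph0.{v}
  let S := SmallModel.{v} P.FullSubcategory
  let F : S ⥤ C := (equivSmallModel.{v} P.FullSubcategory).inverse ⋙ P.ι
  -- Density makes the restricted Yoneda functor fully faithful; the left Kan extension of `F` along
  -- Yoneda is its left adjoint.
  have : F.IsDense := inferInstance
  let R := Presheaf.restrictedULiftYoneda.{v} F
  have : uliftYoneda.{v}.HasPointwiseLeftKanExtension F := fun X ↦ by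
    have : HasColimitsOfShape (CostructuredArrow uliftYoneda.{v} X) C :=
      inferInstance
    dsimp [Functor.HasPointwiseLeftKanExtensionAt]
    infer_instance
  let adj := Presheaf.uliftYonedaAdjunction.{v} _ (uliftYoneda.{v}.leftKanExtensionUnit F)
  let _ : Reflective R := { L := _, adj := adj }
  exact hasLimits_of_reflective R

end Limits

/-- The objects of a small family of objects of a locally finitely presentable category are all
`κ`-presentable for some regular cardinal `κ`. -/
lemma exists_isCardinalPresentable {C : Type u} [Category.{v} C]
    [IsLocallyFinitelyPresentable.{v} C] (J : MorphismProperty C)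
    [MorphismProperty.IsSmall.{v} J] :
    ∃ (κ : Cardinal.{v}) (_ : Fact κ.IsRegular),
      ∀ ⦃A B : C⦄ (j : A ⟶ B), J j → IsCardinalPresentable A κ := by
  have : Fact Cardinal.aleph0.{v}.IsRegular := Cardinal.fact_isRegular_aleph0
  have : IsLocallyPresentable.{v} C := ⟨Cardinal.aleph0, inferInstance, inferInstance⟩
  have (X : C) : IsPresentable.{v} X := inferInstance
  have (X : C) : ∃ (κ : Cardinal.{v}) (_ : Fact κ.IsRegular), IsCardinalPresentable X κ :=
    (this X).exists_cardinal
  choose κ hκ hX using this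
  let e := equivShrink.{v} J.toSet
  -- The maximum with `aleph0` makes `μ` infinite, so that its successor is regular.
  let μ : Cardinal.{v} := max Cardinal.aleph0 (⨆ i : Shrink.{v} J.toSet, κ (e.symm i).1.left)
  have : Fact (Order.succ μ).IsRegular := ⟨Cardinal.isRegular_succ (le_max_left _ _)⟩
  refine ⟨Order.succ μ, this, fun A B j hj ↦ ?_⟩
  refine isCardinalPresentable_of_le A (κ := κ A) ((le_trans ?_ (le_max_right _ _)).trans
    (Order.le_succ μ))
  simpa [e] using le_ciSup (f := fun i : Shrink.{v} J.toSet ↦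
    κ (e.symm i).1.left) Cardinal.bddAbove_of_small (e ⟨Arrow.mk j, hj⟩)

/-! ### Extending maps along transfinite sequences -/

section Transfinite

variable {E : Type*} [Category* E] {I : Type*} [LinearOrder I] [OrderBot I] [SuccOrder I]
  [NoMaxOrder I] [WellFoundedLT I]

/-- If the maps out of each successor stage of a transfinite sequence which satisfy a certain
condition correspond to the maps out of the stage before, then a map out of the first stage has a
unique extension to each stage which satisfies the conditions at all the stages before. -/
lemma existsUnique_extension (D : I ⥤ E) [D.IsWellOrderContinuous] {G : E}
    (R : ∀ i : I, (D.obj (Order.succ i) ⟶ G) → Prop)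
    (hR : ∀ (i : I) (u : D.obj i ⟶ G),
      ∃! v : D.obj (Order.succ i) ⟶ G, D.map (homOfLE (Order.le_succ i)) ≫ v = u ∧ R i v)
    (u₀ : D.obj ⊥ ⟶ G) (j : I) :
    ∃! v : D.obj j ⟶ G, D.map (homOfLE bot_le) ≫ v = u₀ ∧
      ∀ (i : I) (h : Order.succ i ≤ j), R i (D.map (homOfLE h) ≫ v) := by
  induction j using SuccOrder.limitRecOn with
  | isMin j hj =>
    obtain rfl := hj.eq_bot
    have hid : D.map (homOfLE (bot_le : (⊥ : I) ≤ ⊥)) = 𝟙 _ := D.map_id _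
    refine ⟨u₀, ⟨by rw [hid, Category.id_comp], fun i h ↦ ?_⟩, fun v hv ↦ ?_⟩
    · exact absurd (Order.succ_le_iff.1 h) not_lt_bot
    · rw [← hv.1, hid, Category.id_comp]
  | succ j _ ih =>
    obtain ⟨u, ⟨hu₁, hu₂⟩, hu₃⟩ := ih
    obtain ⟨v, ⟨hv₁, hv₂⟩, hv₃⟩ := hR j u
    have key (i : I) (h : Order.succ i ≤ j) (w : D.obj (Order.succ j) ⟶ G) :
        D.map (homOfLE (h.trans (Order.le_succ j))) ≫ w =
          D.map (homOfLE h) ≫ D.map (homOfLE (Order.le_succ j)) ≫ w := by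
      rw [← D.map_comp_assoc]; rfl
    have key' (w : D.obj (Order.succ j) ⟶ G) :
        D.map (homOfLE bot_le) ≫ w =
          D.map (homOfLE bot_le) ≫ D.map (homOfLE (Order.le_succ j)) ≫ w := by
      rw [← D.map_comp_assoc]; rfl
    have hid : D.map (homOfLE (le_refl (Order.succ j))) = 𝟙 _ := D.map_id _
    refine ⟨v, ⟨by rw [key', hv₁, hu₁], fun i h ↦ ?_⟩, fun w ⟨hw₁, hw₂⟩ ↦ ?_⟩
    · rcases (Order.succ_le_succ_iff.1 h).eq_or_lt with rfl | hij
      · rwa [hid, Category.id_comp]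
      · rw [key i (Order.succ_le_of_lt hij), hv₁]
        exact hu₂ i _
    · refine hv₃ w ⟨hu₃ _ ⟨?_, fun i h ↦ ?_⟩, ?_⟩
      · rw [← key', hw₁]
      · rw [← key]
        exact hw₂ i _
      · simpa only [hid, Category.id_comp] using hw₂ j le_rfl
  | isSuccLimit j hj ih =>
    choose u hu hu' using ih
    -- Uniqueness at the earlier stages makes the extensions compatible, so they form a cocone below
    -- the limit stage.
    have hres (i k : I) (hik : i ≤ k) (hk : k < j) :
        D.map (homOfLE hik) ≫ u k hk = u i (hik.trans_lt hk) := by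
      refine hu' _ _ _ ⟨?_, fun l hl ↦ ?_⟩
      · rw [← D.map_comp_assoc]
        exact (hu k hk).1
      · rw [← D.map_comp_assoc]
        exact (hu k hk).2 l (hl.trans hik)
    have hc := D.isColimitOfIsWellOrderContinuous j hj
    let c : Cocone ((Set.principalSegIio j).monotone.functor ⋙ D) :=
      { pt := G
        ι :=
          { app := fun i ↦ u i.1 i.2
            naturality := fun i k φ ↦
              (hres i.1 k.1 (leOfHom φ) k.2).trans (Category.comp_id _).symm } }
    have hfac (i : I) (hi : i < j) : D.map (homOfLE hi.le) ≫ hc.desc c = u i hi :=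
      hc.fac c ⟨i, hi⟩
    have hbot : (⊥ : I) < j := hj.bot_lt
    refine ⟨hc.desc c, ⟨?_, fun i h ↦ ?_⟩, fun w ⟨hw₁, hw₂⟩ ↦ hc.hom_ext fun i ↦ ?_⟩
    · rw [hfac ⊥ hbot, ← (hu ⊥ hbot).1]
      exact ((Category.id_comp _).symm.trans (congrArg (· ≫ u ⊥ hbot) (D.map_id ⊥).symm))
    · have hi : Order.succ i < j := hj.succ_lt (Order.succ_le_iff.1 h)
      rw [hfac _ hi]
      simpa only [show D.map (homOfLE (le_refl (Order.succ i))) = 𝟙 _ from D.map_id _,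
        Category.id_comp] using (hu _ hi).2 i le_rfl
    · rw [hc.fac]
      refine hu' i.1 i.2 _ ⟨?_, fun l hl ↦ ?_⟩
      · rw [← hw₁]
        exact (D.map_comp_assoc _ _ _).symm
      · have := hw₂ l (hl.trans i.2.le)
        rwa [show homOfLE (hl.trans i.2.le) = homOfLE hl ≫ homOfLE i.2.le from rfl,
          D.map_comp_assoc] at this

/-- If the maps out of each successor stage of a transfinite sequence which satisfy a certain
condition correspond to the maps out of the stage before, then a map out of the first stage has an
extension to the colimit which satisfies the conditions at all stages. -/
lemma exists_extension_of_isColimit (D : I ⥤ E) [D.IsWellOrderContinuous] {G : E}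
    (R : ∀ i : I, (D.obj (Order.succ i) ⟶ G) → Prop)
    (hR : ∀ (i : I) (u : D.obj i ⟶ G),
      ∃! v : D.obj (Order.succ i) ⟶ G, D.map (homOfLE (Order.le_succ i)) ≫ v = u ∧ R i v)
    (u₀ : D.obj ⊥ ⟶ G) {c : Cocone D} (hc : IsColimit c) :
    ∃ v : c.pt ⟶ G, c.ι.app ⊥ ≫ v = u₀ ∧ ∀ i : I, R i (c.ι.app (Order.succ i) ≫ v) := by
  choose u hu hu' using existsUnique_extension D R hR u₀
  let d : Cocone D :=
    { pt := G
      ι :=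
        { app := u
          naturality := fun i k φ ↦ by
            have : D.map φ ≫ u k = u i := by
              refine hu' _ _ ⟨?_, fun l hl ↦ ?_⟩
              · rw [← D.map_comp_assoc]
                exact (hu k).1
              · rw [← D.map_comp_assoc]
                exact (hu k).2 l (hl.trans (leOfHom φ))
            simpa using this } }
  refine ⟨hc.desc d, ?_, fun i ↦ ?_⟩
  · rw [hc.fac, ← (hu ⊥).1]
    exact ((Category.id_comp _).symm.trans (congrArg (· ≫ u ⊥) (D.map_id ⊥).symm))
  · rw [hc.fac]
    simpa only [show D.map (homOfLE (le_refl (Order.succ i))) = 𝟙 _ from D.map_id _,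
      Category.id_comp] using (hu _).2 i le_rfl

end Transfinite

/-! ### Attaching one cell for each square -/

section CellAttachment

variable {C : Type u} [Category.{v} C] (J : MorphismProperty C)

/-- The structure, on a map `p : Z ⟶ Z'` over `Y`, of an attachment of one cell for each square
from a map of `J` to `Z ⟶ Y`. -/
structure CellAttachment {Y : C} {Z Z' : Over Y} (p : Z ⟶ Z') where
  cell : ∀ ⦃A B : C⦄ (j : A ⟶ B), J j → ∀ (h : A ⟶ Z.left) (k : B ⟶ Y),
    h ≫ Z.hom = j ≫ k → (B ⟶ Z'.left)
  cell_left : ∀ ⦃A B : C⦄ (j : A ⟶ B) (hj : J j) (h : A ⟶ Z.left) (k : B ⟶ Y)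
    (w : h ≫ Z.hom = j ≫ k), j ≫ cell j hj h k w = h ≫ p.left
  cell_right : ∀ ⦃A B : C⦄ (j : A ⟶ B) (hj : J j) (h : A ⟶ Z.left) (k : B ⟶ Y)
    (w : h ≫ Z.hom = j ≫ k), cell j hj h k w ≫ Z'.hom = k
  existsUnique : ∀ (G : AAF J Y) (u : Z ⟶ Over.mk G.map), ∃! v : Z' ⟶ Over.mk G.map,
    p ≫ v = u ∧ ∀ ⦃A B : C⦄ (j : A ⟶ B) (hj : J j) (h : A ⟶ Z.left) (k : B ⟶ Y)
      (w : h ≫ Z.hom = j ≫ k), cell j hj h k w ≫ v.left =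
        G.φ.lift j hj (h ≫ u.left) k (by rw [Category.assoc, ← w]; congr 1; exact Over.w u)

variable [HasPushouts C] {Y : C} (Z : Over Y)
  [HasColimitsOfShape (Discrete (SmallObject.FunctorObjIndex J.homFamily Z.hom)) C]

open SmallObject

/-- The attachment of a cell for each square to a given map. -/
noncomputable def cellAttachment :
    CellAttachment J (Z := Z) (Z' := Over.mk (πFunctorObj J.homFamily Z.hom))
      (Over.homMk (ιFunctorObj J.homFamily Z.hom) (by simp)) where
  cell A B j hj h k w :=
    Sigma.ι (functorObjTgtFamily J.homFamily Z.hom)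
      (FunctorObjIndex.mk (f := J.homFamily) (⟨Arrow.mk j, hj⟩ : J.toSet) h k w) ≫
        ρFunctorObj J.homFamily Z.hom
  cell_left A B j hj h k w := FunctorObjIndex.comm J.homFamily Z.hom
      (FunctorObjIndex.mk (f := J.homFamily) (⟨Arrow.mk j, hj⟩ : J.toSet) h k w)
  cell_right A B j hj h k w := by simp
  existsUnique G u := by
    have hu : u.left ≫ G.map = Z.hom := Over.w u
    -- The liftings of `G` prescribe the image of every new cell; `u` and these images glue over the
    -- pushout.
    let t : ∐ functorObjTgtFamily J.homFamily Z.hom ⟶ G.dom :=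
      Sigma.desc fun x ↦ G.φ.lift _ x.i.2 (x.t ≫ u.left) x.b (by
        rw [Category.assoc, hu]; exact x.w)
    have ht : functorObjTop J.homFamily Z.hom ≫ u.left =
        functorObjLeft J.homFamily Z.hom ≫ t := by
      refine Sigma.hom_ext _ _ fun x ↦ ?_
      rw [Sigma.ι_desc_assoc, Sigma.ι_map_assoc, Sigma.ι_desc]
      exact (G.φ.fac_left _ _ _ _ _).symm
    refine ⟨Over.homMk (pushout.desc u.left t ht) ?_, ⟨?_, ?_⟩, ?_⟩
    · refine pushout.hom_ext ?_ (Sigma.hom_ext _ _ fun x ↦ ?_)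
      · rw [pushout.inl_desc_assoc]
        exact hu.trans (ιFunctorObj_πFunctorObj J.homFamily Z.hom).symm
      · rw [pushout.inr_desc_assoc, Sigma.ι_desc_assoc]
        refine (G.φ.fac_right _ _ _ _ _).trans ?_
        simp
    · ext
      exact pushout.inl_desc _ _ _
    · intro A B j hj h k w
      change (_ ≫ _) ≫ pushout.desc u.left t ht = _
      rw [Category.assoc, pushout.inr_desc]
      exact Sigma.ι_desc _ _
    · rintro v ⟨rfl, hv⟩
      ext
      change v.left = pushout.desc _ t ht
      refine pushout.hom_ext ?_ (Sigma.hom_ext _ _ fun x ↦ ?_)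
      · exact (pushout.inl_desc _ _ _).symm
      · rw [pushout.inr_desc, ← Category.assoc]
        refine (hv x.i.1.hom x.i.2 x.t x.b x.w).trans ?_
        symm
        exact Sigma.ι_desc _ _

end CellAttachment

/-! ### Free algebraic acyclic fibrations, by cells and equalizers -/

section Free

variable {C : Type u} [Category.{v} C] [IsLocallyFinitelyPresentable.{v} C]
  (J : MorphismProperty C) [MorphismProperty.IsSmall.{v} J]

open SmallObject in
/-- Every map `f` factors through an algebraic acyclic fibration which maps to all the others
through which `f` factors: the transfinite composite of the attachments of cells. -/
lemma exists_weakly_initial_factorisation {X Y : C} (f : X ⟶ Y) :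
    ∃ (T : AAF J Y) (l : X ⟶ T.dom), l ≫ T.map = f ∧
      ∀ (G : AAF J Y) (m : X ⟶ G.dom), m ≫ G.map = f → ∃ u : T ⟶ G, l ≫ u.hom = m := by
  have : Fact Cardinal.aleph0.{v}.IsRegular := Cardinal.fact_isRegular_aleph0
  have : HasColimitsOfSize.{v, v} C :=
    IsCardinalLocallyPresentable.toHasColimitsOfSize Cardinal.aleph0.{v}
  obtain ⟨κ, _, hκ⟩ := exists_isCardinalPresentable J
  have : Nonempty κ.ord.ToType := by simpa using Cardinal.IsRegular.ne_zero Fact.out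
  have := WellFoundedLT.toOrderBot κ.ord.ToType
  have := Cardinal.noMaxOrder (Fact.elim inferInstance : κ.IsRegular).aleph0_le
  have (Z : Over Y) :
      HasColimitsOfShape (Discrete (FunctorObjIndex J.homFamily Z.hom)) C :=
    hasColimitsOfShape_of_equivalence (Discrete.equivalence (equivShrink.{v} _)).symm
  let Φ : SuccStruct (Over Y) :=
    { X₀ := Over.mk f
      succ Z := Over.mk (πFunctorObj J.homFamily Z.hom)
      toSucc Z := Over.homMk (ιFunctorObj J.homFamily Z.hom) (by simp) }
  let D := Φ.iterationFunctor κ.ord.ToType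
  let c : Cocone D := Φ.iterationCocone κ.ord.ToType
  have hc : IsColimit c := Φ.isColimitIterationCocone κ.ord.ToType
  have hΦ {Z Z' : Over Y} (p : Z ⟶ Z') (hp : Φ.prop p) : Nonempty (CellAttachment J p) := by
    obtain ⟨Z⟩ := hp
    exact ⟨cellAttachment J Z⟩
  let K (i : κ.ord.ToType) : CellAttachment J (D.map (homOfLE (Order.le_succ i))) :=
    (hΦ _ (Φ.prop_iterationFunctor_map_succ i (not_isMax i))).some
  have hιw (i : κ.ord.ToType) : (c.ι.app i).left ≫ c.pt.hom = (D.obj i).hom := Over.w _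
  -- Domains of maps in `J` are `κ`-presentable, so a map from one to the colimit over `κ.ord`
  -- factors through a stage.
  have hfac ⦃A B : C⦄ (j : A ⟶ B) (hj : J j) (h : A ⟶ c.pt.left) :
      ∃ (i : κ.ord.ToType) (t : A ⟶ (D.obj i).left), t ≫ (c.ι.app i).left = h := by
    have := hκ j hj
    exact IsCardinalPresentable.exists_hom_of_isColimit κ
      (isColimitOfPreserves (Over.forget Y) hc) h
  -- The stage is an arbitrary choice. Maps out of `T` need only respect the cells at chosen stages,
  -- whence weak initiality only.
  choose st t ht using hfac
  have hw ⦃A B : C⦄ (j : A ⟶ B) (hj : J j) (h : A ⟶ c.pt.left) (k : B ⟶ Y)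
      (w : h ≫ c.pt.hom = j ≫ k) : t j hj h ≫ (D.obj (st j hj h)).hom = j ≫ k := by
    rw [← w, ← hιw, ← Category.assoc, ht]
  have hmap (i : κ.ord.ToType) :
      (D.map (homOfLE (Order.le_succ i))).left ≫ (c.ι.app (Order.succ i)).left =
        (c.ι.app i).left := by
    rw [← Over.comp_left, c.w]
  let T : AAF J Y :=
    { dom := c.pt.left
      map := c.pt.hom
      φ :=
        { lift := fun A B j hj h k w ↦
            (K _).cell j hj (t j hj h) k (hw j hj h k w) ≫ (c.ι.app _).left
          fac_left := fun A B j hj h k w ↦ by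
            rw [← Category.assoc, (K _).cell_left, Category.assoc, hmap, ht]
          fac_right := fun A B j hj h k w ↦ by
            rw [Category.assoc, hιw, (K _).cell_right] } }
  refine ⟨T, (Φ.ιIteration κ.ord.ToType).left, Over.w (Φ.ιIteration κ.ord.ToType), ?_⟩
  intro G m hm
  let u₀ : D.obj ⊥ ⟶ Over.mk G.map :=
    (Φ.iterationFunctorObjBotIso κ.ord.ToType).hom ≫ Over.homMk m hm
  have wR {i : κ.ord.ToType} (z : D.obj i ⟶ Over.mk G.map) ⦃A B : C⦄ {j : A ⟶ B}
      {h : A ⟶ (D.obj i).left} {k : B ⟶ Y} (w : h ≫ (D.obj i).hom = j ≫ k) :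
      (h ≫ z.left) ≫ G.map = j ≫ k := by
    rw [Category.assoc, ← w]
    congr 1
    exact Over.w z
  -- The extension sends the cells of every stage to liftings of `G`, in particular those defining
  -- the liftings of `T`.
  obtain ⟨z, hz₀, hz⟩ := exists_extension_of_isColimit D
    (fun i z ↦ ∀ ⦃A B : C⦄ (j : A ⟶ B) (hj : J j) (h : A ⟶ (D.obj i).left) (k : B ⟶ Y)
      (w : h ≫ (D.obj i).hom = j ≫ k), (K i).cell j hj h k w ≫ z.left =
        G.φ.lift j hj (h ≫ (D.map (homOfLE (Order.le_succ i)) ≫ z).left) k (wR _ w))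
    (fun i u ↦ by
      obtain ⟨z, ⟨rfl, hz⟩, hz'⟩ := (K i).existsUnique G u
      refine ⟨z, ⟨rfl, hz⟩, fun y ⟨hy, hy'⟩ ↦ hz' y ⟨hy, fun A B j hj h k w ↦ ?_⟩⟩
      rw [hy' j hj h k w]
      simp only [hy])
    u₀ hc
  refine ⟨⟨z.left, Over.w z, fun A B j hj h k e ↦ ?_⟩, ?_⟩
  · change ((K _).cell j hj (t j hj h) k _ ≫ (c.ι.app _).left) ≫ z.left = _
    rw [Category.assoc, ← Over.comp_left, hz _ j hj _ k (hw j hj h k e)]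
    congr 1
    rw [c.w_assoc, Over.comp_left, ← Category.assoc, ht]
  · have : Φ.ιIteration κ.ord.ToType ≫ z = Over.homMk m hm := by
      change ((Φ.iterationFunctorObjBotIso κ.ord.ToType).inv ≫ c.ι.app ⊥) ≫ z = _
      rw [Category.assoc, hz₀]
      simp [u₀]
    exact congrArg (fun q ↦ q.left) this

omit [MorphismProperty.IsSmall.{v} J] in
/-- A family of parallel maps of algebraic acyclic fibrations has an equalizer, created in the
ambient category. -/
lemma exists_equalizing_AAF {Y : C} {F G : AAF J Y} {ι : Type v} [Nonempty ι]
    (a : ι → (F ⟶ G)) :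
    ∃ (E : AAF J Y) (e : E ⟶ F), Mono e.hom ∧ (∀ i i', e ≫ a i = e ≫ a i') ∧
      ∀ {X : C} (l : X ⟶ F.dom), (∀ i i', l ≫ (a i).hom = l ≫ (a i').hom) →
        ∃ l' : X ⟶ E.dom, l' ≫ e.hom = l := by
  let b : ι → (F.dom ⟶ G.dom) := fun i ↦ (a i).hom
  have hb (i i' : ι) : wideEqualizer.ι b ≫ (a i).hom = wideEqualizer.ι b ≫ (a i').hom :=
    wideEqualizer.condition b i i'
  let E : AAF J Y :=
    { dom := wideEqualizer b
      map := wideEqualizer.ι b ≫ F.map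
      φ :=
        -- The lifting taken in `F` is equalised because each `a i` carries it to the lifting in `G`
        -- of the same square.
        { lift := fun A B j hj h k w ↦ wideEqualizer.lift
            (F.φ.lift j hj (h ≫ wideEqualizer.ι b) k (by rw [Category.assoc, w])) (by
              intro i i'
              simp only [b, (a _).lift_hom, Category.assoc, hb i i'])
          fac_left := fun A B j hj h k w ↦ by
            rw [← cancel_mono (wideEqualizer.ι b), Category.assoc, wideEqualizer.lift_ι,
              F.φ.fac_left]
          fac_right := fun A B j hj h k w ↦ by
            rw [← Category.assoc, wideEqualizer.lift_ι, F.φ.fac_right] } }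
  refine ⟨E, ⟨wideEqualizer.ι b, rfl, fun A B j hj h k e ↦ wideEqualizer.lift_ι _ _⟩,
    inferInstanceAs (Mono (wideEqualizer.ι b)), fun i i' ↦ AAF.Hom.ext (hb i i'),
    fun l hl ↦ ⟨wideEqualizer.lift l hl, wideEqualizer.lift_ι _ _⟩⟩

/-- Every map `f` factors through a free algebraic acyclic fibration. -/
theorem exists_free_factorisation {X Y : C} (f : X ⟶ Y) :
    ∃ (F : AAF J Y) (l : X ⟶ F.dom), l ≫ F.map = f ∧
      ∀ (G : AAF J Y) (m : X ⟶ G.dom), m ≫ G.map = f → ∃! u : F ⟶ G, l ≫ u.hom = m := by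
  obtain ⟨T, l, hl, hT⟩ := exists_weakly_initial_factorisation J f
  -- The family `a` lists all endomorphisms of `T` under `X`, including the identity.
  obtain ⟨ι, hι, a, ha, ha'⟩ : ∃ (ι : Type v) (_ : Nonempty ι) (a : ι → (T ⟶ T)),
      (∀ i, l ≫ (a i).hom = l) ∧ ∀ g : T ⟶ T, l ≫ g.hom = l → ∃ i, a i = g := by
    let S : Set (T.dom ⟶ T.dom) := {g | ∃ g' : T ⟶ T, g'.hom = g ∧ l ≫ g = l}
    refine ⟨S, ⟨𝟙 _, 𝟙 T, rfl, Category.comp_id _⟩, fun g ↦ g.2.choose, fun g ↦ ?_,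
      fun g hg ↦ ⟨⟨g.hom, g, rfl, hg⟩, ?_⟩⟩
    · rw [g.2.choose_spec.1, g.2.choose_spec.2]
    · exact AAF.Hom.ext (Exists.choose_spec (p := fun g' : T ⟶ T ↦ g'.hom = g.hom ∧ _) _).1
  obtain ⟨E, e, he, hea, hel⟩ := exists_equalizing_AAF J a
  obtain ⟨l', hl'⟩ := hel l fun i i' ↦ by rw [ha, ha]
  refine ⟨E, l', by rw [← e.w, ← Category.assoc, hl', hl], fun G m hm ↦ ?_⟩
  obtain ⟨u, hu⟩ := hT G m hm
  refine ⟨e ≫ u, ?_, fun v hv ↦ ?_⟩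
  · change l' ≫ e.hom ≫ u.hom = m
    rw [← Category.assoc, hl', hu]
  · dsimp at hv
    have huv : l' ≫ e.hom ≫ u.hom = m := by rw [← Category.assoc, hl', hu]
    -- The two candidates agree on their equalizer `E'`, so it suffices that `e'` has a section;
    -- weak initiality provides `h : T ⟶ E'`.
    obtain ⟨E', e', -, hea', hel'⟩ := exists_equalizing_AAF J
      (fun i : ULift.{v} Bool ↦ bif i.down then v else e ≫ u)
    have hve : e' ≫ v = e' ≫ e ≫ u := hea' ⟨true⟩ ⟨false⟩
    obtain ⟨l'', hl''⟩ := hel' l' (by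
      have : l' ≫ (e ≫ u).hom = m := huv
      rintro ⟨_ | _⟩ ⟨_ | _⟩ <;> simp [hv, this])
    obtain ⟨h, hh⟩ := hT E' l'' (by rw [← e'.w, ← Category.assoc, hl'', ← e.w, ← Category.assoc, hl', hl])
    -- Both `h ≫ e' ≫ e` and the identity are endomorphisms of `T` under `X`, so `e` equalises them;
    -- cancel the mono `e`.
    have hid : e.hom ≫ h.hom ≫ e'.hom = 𝟙 _ := by
      obtain ⟨i, hi⟩ := ha' (h ≫ e' ≫ e) (by
        change l ≫ h.hom ≫ e'.hom ≫ e.hom = l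
        rw [← Category.assoc, hh, ← Category.assoc, hl'', hl'])
      obtain ⟨i', hi'⟩ := ha' (𝟙 T) (Category.comp_id _)
      have := congrArg AAF.Hom.hom (hea i i')
      rw [hi, hi'] at this
      rw [← cancel_mono e.hom, Category.id_comp, Category.assoc, Category.assoc]
      exact this.trans (Category.comp_id _)
    have hid' : e ≫ h ≫ e' = 𝟙 E := AAF.Hom.ext hid
    calc v = (e ≫ h ≫ e') ≫ v := by rw [hid', Category.id_comp]
      _ = e ≫ h ≫ e' ≫ e ≫ u := by rw [Category.assoc, Category.assoc, hve]
      _ = (e ≫ h ≫ e') ≫ e ≫ u := by simp only [Category.assoc]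
      _ = e ≫ u := by rw [hid', Category.id_comp]

end Free

/-! ### Squares respecting liftings, and free factorisations -/

section LiftHom

variable {C : Type u} [Category.{v} C] {J : MorphismProperty C}

/-- A commutative square `(u, v) : f ⟶ g` which commutes with given choices of liftings. -/
structure IsLiftHom {Y X Y' X' : C} {f : Y ⟶ X} {g : Y' ⟶ X'} (φ : Liftings J f)
    (ψ : Liftings J g) (u : Y ⟶ Y') (v : X ⟶ X') : Prop where
  w : u ≫ g = f ≫ v
  lift_comp : ∀ ⦃A B : C⦄ (j : A ⟶ B) (hj : J j) (h : A ⟶ Y) (k : B ⟶ X) (e : h ≫ f = j ≫ k),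
    φ.lift j hj h k e ≫ u = ψ.lift j hj (h ≫ u) (k ≫ v) (by
      rw [Category.assoc, w, ← Category.assoc, e, Category.assoc])

lemma Liftings.lift_congr {Y X : C} {f : Y ⟶ X} (φ : Liftings J f) {A B : C} (j : A ⟶ B)
    (hj : J j) {h h' : A ⟶ Y} {k k' : B ⟶ X} (e : h ≫ f = j ≫ k) (hh : h = h') (hk : k = k') :
    φ.lift j hj h k e = φ.lift j hj h' k' (by rw [← hh, ← hk, e]) := by
  subst hh hk
  rfl

namespace IsLiftHom

lemma id {Y X : C} {f : Y ⟶ X} (φ : Liftings J f) : IsLiftHom φ φ (𝟙 Y) (𝟙 X) where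
  w := by simp
  lift_comp _ _ j hj h k e := by simp

lemma comp {Y X Y' X' Y'' X'' : C} {f : Y ⟶ X} {g : Y' ⟶ X'} {l : Y'' ⟶ X''}
    {φ : Liftings J f} {ψ : Liftings J g} {χ : Liftings J l} {u : Y ⟶ Y'} {v : X ⟶ X'}
    {u' : Y' ⟶ Y''} {v' : X' ⟶ X''} (a : IsLiftHom φ ψ u v) (b : IsLiftHom ψ χ u' v') :
    IsLiftHom φ χ (u ≫ u') (v ≫ v') where
  w := by rw [Category.assoc, b.w, ← Category.assoc, a.w, Category.assoc]
  lift_comp _ _ j hj h k e := by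
    rw [← Category.assoc, a.lift_comp, b.lift_comp]
    exact χ.lift_congr _ _ _ (Category.assoc _ _ _) (Category.assoc _ _ _)

lemma congr {Y X Y' X' : C} {f : Y ⟶ X} {g : Y' ⟶ X'} {φ : Liftings J f}
    {ψ : Liftings J g} {u u' : Y ⟶ Y'} {v v' : X ⟶ X'} (a : IsLiftHom φ ψ u v)
    (hu : u = u') (hv : v = v') : IsLiftHom φ ψ u' v' := by
  subst hu hv
  exact a

lemma vcomp {Y X W Y' X' W' : C} {f : Y ⟶ X} {g : X ⟶ W} {f' : Y' ⟶ X'} {g' : X' ⟶ W'}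
    {φ : Liftings J f} {ψ : Liftings J g} {φ' : Liftings J f'} {ψ' : Liftings J g'}
    {u : Y ⟶ Y'} {v : X ⟶ X'} {x : W ⟶ W'} (a : IsLiftHom φ φ' u v) (b : IsLiftHom ψ ψ' v x) :
    IsLiftHom (φ.comp ψ) (φ'.comp ψ') u x where
  w := by rw [← Category.assoc, a.w, Category.assoc, b.w, Category.assoc]
  lift_comp _ _ j hj h k e := by
    refine (a.lift_comp _ _ _ _ _).trans (φ'.lift_congr _ _ _ rfl ?_)
    rw [b.lift_comp]
    exact ψ'.lift_congr _ _ _ (by rw [Category.assoc, Category.assoc, a.w]) rfl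

/-- The composite lifting is a lifting over the inner one, so projecting it along `f` recovers the
inner one. This gives the counit law `sigma_rho`. -/
lemma comp_fst {Y X W : C} {f : Y ⟶ X} {g : X ⟶ W} (φ : Liftings J f) (ψ : Liftings J g) :
    IsLiftHom (φ.comp ψ) ψ f (𝟙 W) where
  w := (Category.comp_id _).symm
  lift_comp _ _ _ _ _ _ _ :=
    (φ.fac_right _ _ _ _ _).trans (ψ.lift_congr _ _ _ rfl (Category.comp_id _).symm)

/-- The lifting along `g` disappears after composing with `g`. Needed for `P(1, ρ_f)` in the other
counit law. -/
lemma comp_of {Y X W Y' W' : C} {f : Y ⟶ X} {g : X ⟶ W} {l : Y' ⟶ W'} {φ : Liftings J f}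
    (ψ : Liftings J g) {χ : Liftings J l} {u : Y ⟶ Y'} {x : W ⟶ W'}
    (a : IsLiftHom φ χ u (g ≫ x)) : IsLiftHom (φ.comp ψ) χ u x where
  w := by rw [a.w, Category.assoc]
  lift_comp _ _ j hj h k e :=
    (a.lift_comp _ _ _ _ _).trans (χ.lift_congr _ _ _ rfl (by
      rw [← Category.assoc, ψ.fac_right]))

lemma comp_assoc {Y X W V : C} {f : Y ⟶ X} {g : X ⟶ W} {l : W ⟶ V} (φ : Liftings J f)
    (ψ : Liftings J g) (χ : Liftings J l) :
    IsLiftHom ((φ.comp ψ).comp χ) (φ.comp (ψ.comp χ)) (𝟙 Y) (𝟙 V) where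
  w := by simp
  lift_comp _ _ j hj h k e := by
    rw [Category.comp_id]
    refine φ.lift_congr _ _ _ (Category.comp_id h).symm (ψ.lift_congr _ _ _ ?_
      (χ.lift_congr _ _ _ ?_ ?_)) <;> simp

end IsLiftHom

/-- The choice of liftings induced on a pullback. -/
noncomputable def Liftings.pullback {Z W Y : C} {g : Z ⟶ W} (ψ : Liftings J g) (k : Y ⟶ W)
    [HasPullback g k] : Liftings J (pullback.snd g k) where
  lift _ _ j hj a b e := pullback.lift (ψ.lift j hj (a ≫ pullback.fst g k) (b ≫ k) (by
    rw [Category.assoc, pullback.condition, ← Category.assoc, e, Category.assoc])) b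
      (ψ.fac_right _ _ _ _ _)
  fac_left _ _ j hj a b e := by
    ext
    · rw [Category.assoc, pullback.lift_fst, ψ.fac_left]
    · rw [Category.assoc, pullback.lift_snd, e]
  fac_right _ _ j hj a b e := pullback.lift_snd _ _ _

lemma IsLiftHom.pullback_fst {Z W Y : C} {g : Z ⟶ W} (ψ : Liftings J g) (k : Y ⟶ W)
    [HasPullback g k] : IsLiftHom (ψ.pullback k) ψ (pullback.fst g k) k where
  w := pullback.condition
  lift_comp _ _ _ _ _ _ _ := pullback.lift_fst _ _ _

lemma IsLiftHom.pullback_lift {Z W Y Z' Y' : C} {g : Z ⟶ W} {ψ : Liftings J g} {k : Y ⟶ W}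
    [HasPullback g k] {g' : Z' ⟶ Y'} {φ : Liftings J g'} {u : Z' ⟶ Z} {x : Y' ⟶ Y}
    (a : IsLiftHom φ ψ u (x ≫ k)) :
    IsLiftHom φ (ψ.pullback k) (pullback.lift u (g' ≫ x) (by rw [a.w, Category.assoc])) x where
  w := pullback.lift_snd _ _ _
  lift_comp _ _ j hj h k e := by
    ext
    · rw [Category.assoc, pullback.lift_fst, a.lift_comp]
      refine Eq.trans ?_ (pullback.lift_fst _ _ _).symm
      exact ψ.lift_congr _ _ _ (by rw [Category.assoc, pullback.lift_fst])
        (Category.assoc _ _ _).symm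
    · refine Eq.trans ?_ (pullback.lift_snd _ _ _).symm
      rw [Category.assoc, pullback.lift_snd, ← Category.assoc, φ.fac_right]

/-- Every map with the right lifting property has a choice of liftings. -/
lemma nonempty_liftings {Y X : C} {f : Y ⟶ X} (hf : J.rlp f) : Nonempty (Liftings J f) := by
  have (A B : C) (j : A ⟶ B) (hj : J j) (h : A ⟶ Y) (k : B ⟶ X) (w : h ≫ f = j ≫ k) :
      ∃ l : B ⟶ Y, j ≫ l = h ∧ l ≫ f = k := by
    have := hf j hj
    have sq : CommSq h j f k := ⟨w⟩
    exact ⟨sq.lift, sq.fac_left, sq.fac_right⟩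
  choose l hl hl' using this
  exact ⟨⟨fun A B j hj h k w ↦ l A B j hj h k w, fun _ _ _ _ _ _ _ ↦ hl _ _ _ _ _ _ _,
    fun _ _ _ _ _ _ _ ↦ hl' _ _ _ _ _ _ _⟩⟩

/-- A map with a choice of liftings has the right lifting property. -/
lemma Liftings.rlp {Y X : C} {f : Y ⟶ X} (φ : Liftings J f) : J.rlp f :=
  fun _ _ j hj ↦ ⟨fun {h k} sq ↦
    ⟨⟨⟨φ.lift j hj h k sq.w, φ.fac_left _ _ _ _ _, φ.fac_right _ _ _ _ _⟩⟩⟩⟩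

lemma IsLiftHom.of_hom {X : C} {F G : AAF J X} (u : F ⟶ G) :
    IsLiftHom F.φ G.φ u.hom (𝟙 X) where
  w := u.w.trans (Category.comp_id _).symm
  lift_comp _ _ j hj h k e :=
    (u.lift_hom j hj h k e).trans (G.φ.lift_congr _ _ _ rfl (Category.comp_id k).symm)

/-- The map of algebraic acyclic fibrations given by a map which commutes with the choices of
liftings. -/
def IsLiftHom.hom {X : C} {F G : AAF J X} {u : F.dom ⟶ G.dom}
    (a : IsLiftHom F.φ G.φ u (𝟙 X)) : F ⟶ G where
  hom := u
  w := a.w.trans (Category.comp_id _)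
  lift_hom _ _ j hj h k e :=
    (a.lift_comp j hj h k e).trans (G.φ.lift_congr _ _ _ rfl (Category.comp_id k))

variable (J) in
/-- A factorisation of `f` through a free map with a choice of liftings. -/
structure FreeFactorisation {X Y : C} (f : X ⟶ Y) where
  obj : C
  lam : X ⟶ obj
  rho : obj ⟶ Y
  fac : lam ≫ rho = f
  φ : Liftings J rho
  existsUnique : ∀ {Z W : C} {g : Z ⟶ W} (ψ : Liftings J g) (h : X ⟶ Z) (k : Y ⟶ W),
    h ≫ g = f ≫ k → ∃! u : obj ⟶ Z, lam ≫ u = h ∧ IsLiftHom φ ψ u k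

variable (J) in
-- A lifting-preserving square over `k : Y ⟶ W` amounts to a map in `AAF/Y` into the pullback along
-- `k`, so initiality over the fixed base `Y` suffices.
lemma nonempty_freeFactorisation [IsLocallyFinitelyPresentable.{v} C]
    [MorphismProperty.IsSmall.{v} J] {X Y : C} (f : X ⟶ Y) :
    Nonempty (FreeFactorisation J f) := by
  obtain ⟨F, l, hl, hF⟩ := exists_free_factorisation J f
  refine ⟨⟨F.dom, l, F.map, hl, F.φ, fun {Z W g} ψ h k w ↦ ?_⟩⟩
  obtain ⟨u, hu, hu'⟩ := hF ⟨pullback.snd g k, ψ.pullback k⟩ (pullback.lift h f w)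
    (pullback.lift_snd _ _ _)
  refine ⟨u.hom ≫ pullback.fst g k, ⟨?_, ?_⟩, ?_⟩
  · rw [← Category.assoc, hu, pullback.lift_fst]
  · exact ((IsLiftHom.of_hom u).comp (IsLiftHom.pullback_fst ψ k)).congr rfl (Category.id_comp k)
  · rintro v ⟨hv, hv'⟩
    have hv'' := IsLiftHom.pullback_lift (x := 𝟙 Y) (hv'.congr rfl (Category.id_comp k).symm)
    have hl' : l ≫ pullback.lift v (F.map ≫ 𝟙 Y) (by
        rw [hv'.w, Category.assoc, Category.id_comp]) = pullback.lift h f w := by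
      refine pullback.hom_ext ?_ ?_
      · rw [Category.assoc, pullback.lift_fst, pullback.lift_fst, hv]
      · rw [Category.assoc, pullback.lift_snd, pullback.lift_snd, Category.comp_id, hl]
    rw [← congrArg AAF.Hom.hom (hu' hv''.hom hl')]
    exact (pullback.lift_fst _ _ _).symm

end LiftHom

/-! ### The realisation built from free factorisations -/

section FreeRealisation

variable {C : Type u} [Category.{v} C] {J : MorphismProperty C}

namespace FreeFactorisation

section

variable {X Y : C} {f : X ⟶ Y} (F : FreeFactorisation J f) {Z W : C} {g : Z ⟶ W}

/-- The map out of a free factorisation given by the universal property. -/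
noncomputable def desc (ψ : Liftings J g) (h : X ⟶ Z) (k : Y ⟶ W) (w : h ≫ g = f ≫ k) :
    F.obj ⟶ Z :=
  (F.existsUnique ψ h k w).choose

lemma lam_desc (ψ : Liftings J g) (h : X ⟶ Z) (k : Y ⟶ W) (w : h ≫ g = f ≫ k) :
    F.lam ≫ F.desc ψ h k w = h :=
  (F.existsUnique ψ h k w).choose_spec.1.1

lemma isLiftHom_desc (ψ : Liftings J g) (h : X ⟶ Z) (k : Y ⟶ W) (w : h ≫ g = f ≫ k) :
    IsLiftHom F.φ ψ (F.desc ψ h k w) k :=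
  (F.existsUnique ψ h k w).choose_spec.1.2

/-- The engine for all the axioms. The bases `k` and `k'` are kept apart because composites of
squares yield bases such as `𝟙 Y ≫ k`. -/
lemma hom_ext {ψ : Liftings J g} {k k' : Y ⟶ W} {a b : F.obj ⟶ Z} (ha : IsLiftHom F.φ ψ a k)
    (hb : IsLiftHom F.φ ψ b k') (hk : k = k') (h : F.lam ≫ a = F.lam ≫ b) : a = b := by
  subst hk
  exact (F.existsUnique ψ (F.lam ≫ a) k
    (by rw [Category.assoc, ha.w, ← Category.assoc, F.fac])).unique ⟨rfl, ha⟩ ⟨h.symm, hb⟩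

/-- In a free factorisation, the first map has the left lifting property against the maps with
the right lifting property against `J`. -/
lemma lam_mem [HasPullbacks C] : J.rlp.llp F.lam := fun Z W g hg ↦ ⟨fun {m k} sq ↦ by
  obtain ⟨ψ⟩ := nonempty_liftings hg
  -- Freeness is applied to the composite of the pullback of `g` with `rho`; by uniqueness `l` is a
  -- section of the pullback projection, hence gives a filler.
  let l := F.desc ((ψ.pullback k).comp F.φ) (pullback.lift m F.lam sq.w) (𝟙 Y) (by
    rw [← Category.assoc, pullback.lift_snd, F.fac, Category.comp_id])
  have hl : F.lam ≫ l = pullback.lift m F.lam sq.w := F.lam_desc _ _ _ _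
  have hl' : l ≫ pullback.snd g k = 𝟙 _ :=
    F.hom_ext ((F.isLiftHom_desc _ _ _ _).comp (IsLiftHom.comp_fst _ _)) (IsLiftHom.id _)
      (Category.comp_id _) (by
        rw [← Category.assoc, hl, pullback.lift_snd, Category.comp_id])
  refine ⟨⟨⟨l ≫ pullback.fst g k, ?_, ?_⟩⟩⟩
  · rw [← Category.assoc, hl, pullback.lift_fst]
  · rw [Category.assoc, pullback.condition, ← Category.assoc, hl', Category.id_comp]⟩

end

variable (F : ∀ {X Y : C} (f : X ⟶ Y), FreeFactorisation J f)

/-- The functoriality of free factorisations. -/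
noncomputable def map {X Y X' Y' : C} {f : X ⟶ Y} {g : X' ⟶ Y'} (h : X ⟶ X') (k : Y ⟶ Y')
    (w : h ≫ g = f ≫ k) : (F f).obj ⟶ (F g).obj :=
  (F f).desc (F g).φ (h ≫ (F g).lam) k (by rw [Category.assoc, (F g).fac, w])

lemma lam_map {X Y X' Y' : C} {f : X ⟶ Y} {g : X' ⟶ Y'} (h : X ⟶ X') (k : Y ⟶ Y')
    (w : h ≫ g = f ≫ k) : (F f).lam ≫ map F h k w = h ≫ (F g).lam :=
  lam_desc _ _ _ _ _

lemma lam_map_assoc {X Y X' Y' Z : C} {f : X ⟶ Y} {g : X' ⟶ Y'} (h : X ⟶ X') (k : Y ⟶ Y')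
    (w : h ≫ g = f ≫ k) (z : (F g).obj ⟶ Z) :
    (F f).lam ≫ map F h k w ≫ z = h ≫ (F g).lam ≫ z := by
  rw [← Category.assoc, lam_map, Category.assoc]

lemma isLiftHom_map {X Y X' Y' : C} {f : X ⟶ Y} {g : X' ⟶ Y'} (h : X ⟶ X') (k : Y ⟶ Y')
    (w : h ≫ g = f ≫ k) : IsLiftHom (F f).φ (F g).φ (map F h k w) k :=
  isLiftHom_desc _ _ _ _ _

/-- The comultiplication of the comonad of free factorisations. -/
noncomputable def sigma {X Y : C} (f : X ⟶ Y) : (F f).obj ⟶ (F (F f).lam).obj :=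
  (F f).desc ((F (F f).lam).φ.comp (F f).φ) (F (F f).lam).lam (𝟙 Y)
    (by rw [← Category.assoc, (F (F f).lam).fac, (F f).fac, Category.comp_id])

lemma lam_sigma {X Y : C} (f : X ⟶ Y) : (F f).lam ≫ sigma F f = (F (F f).lam).lam :=
  lam_desc _ _ _ _ _

lemma lam_sigma_assoc {X Y Z : C} (f : X ⟶ Y) (z : (F (F f).lam).obj ⟶ Z) :
    (F f).lam ≫ sigma F f ≫ z = (F (F f).lam).lam ≫ z := by
  rw [← Category.assoc, lam_sigma]

lemma isLiftHom_sigma {X Y : C} (f : X ⟶ Y) :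
    IsLiftHom (F f).φ ((F (F f).lam).φ.comp (F f).φ) (sigma F f) (𝟙 Y) :=
  isLiftHom_desc _ _ _ _ _

/-- The multiplication of the monad of free factorisations. -/
noncomputable def pi {X Y : C} (f : X ⟶ Y) : (F (F f).rho).obj ⟶ (F f).obj :=
  (F (F f).rho).desc (F f).φ (𝟙 _) (𝟙 Y) (by rw [Category.comp_id, Category.id_comp])

lemma lam_pi {X Y : C} (f : X ⟶ Y) : (F (F f).rho).lam ≫ pi F f = 𝟙 _ :=
  lam_desc _ _ _ _ _

lemma lam_pi_assoc {X Y Z : C} (f : X ⟶ Y) (z : (F f).obj ⟶ Z) :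
    (F (F f).rho).lam ≫ pi F f ≫ z = z := by
  rw [← Category.assoc, lam_pi, Category.id_comp]

lemma isLiftHom_pi {X Y : C} (f : X ⟶ Y) :
    IsLiftHom (F (F f).rho).φ (F f).φ (pi F f) (𝟙 Y) :=
  isLiftHom_desc _ _ _ _ _

lemma sigma_rho {X Y : C} (f : X ⟶ Y) : sigma F f ≫ (F (F f).lam).rho = 𝟙 _ :=
  (F f).hom_ext ((isLiftHom_sigma F f).comp (IsLiftHom.comp_fst _ _)) (IsLiftHom.id _)
    (Category.comp_id _) (by
      rw [← Category.assoc, lam_sigma, (F (F f).lam).fac, Category.comp_id])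

/-- Free factorisations assemble to an algebraic realisation. -/
noncomputable def realisation [HasPullbacks C] : Realisation J.rlp.llp J.rlp where
  P f := (F f).obj
  map h k w := map F h k w
  lam f := (F f).lam
  rho f := (F f).rho
  sigma f := sigma F f
  pi f := pi F f
  fac f := (F f).fac
  lam_mem f := (F f).lam_mem
  rho_mem f := (F f).φ.rlp
  lam_map h k w := lam_map F h k w
  map_rho h k w := (isLiftHom_map F h k w).w
  lam_sigma f := lam_sigma F f
  sigma_rho f := sigma_rho F f
  lam_pi f := lam_pi F f
  pi_rho f := (isLiftHom_pi F f).w.trans (Category.comp_id _)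
  map_id f w := (F f).hom_ext (isLiftHom_map F _ _ _) (IsLiftHom.id _) rfl (by
    rw [lam_map, Category.id_comp, Category.comp_id])
  map_comp {X Y X' Y' X'' Y'' f g l} h k h' k' w w' w'' := (F f).hom_ext (isLiftHom_map F _ _ _)
    ((isLiftHom_map F _ _ _).comp (isLiftHom_map F _ _ _)) rfl (by
      rw [lam_map, lam_map_assoc, lam_map, Category.assoc])
  sigma_naturality {X Y X' Y' f g} h k w := (F f).hom_ext
    ((isLiftHom_map F h k w).comp (isLiftHom_sigma F g))
    ((isLiftHom_sigma F f).comp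
      ((isLiftHom_map F h (map F h k w) (lam_map F h k w).symm).vcomp (isLiftHom_map F h k w)))
    (by rw [Category.comp_id, Category.id_comp]) (by
      rw [lam_map_assoc, lam_sigma, lam_sigma_assoc, lam_map])
  pi_naturality {X Y X' Y' f g} h k w := (F (F f).rho).hom_ext
    ((isLiftHom_pi F f).comp (isLiftHom_map F h k w))
    ((isLiftHom_map F (map F h k w) k (isLiftHom_map F h k w).w).comp (isLiftHom_pi F g))
    (by rw [Category.comp_id, Category.id_comp]) (by
      rw [lam_pi_assoc, lam_map_assoc, lam_pi, Category.comp_id])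
  sigma_counit f := (F f).hom_ext
    ((isLiftHom_sigma F f).comp (IsLiftHom.comp_of _
      ((isLiftHom_map F _ _ _).congr rfl (Category.comp_id _).symm)))
    (IsLiftHom.id _) (Category.comp_id _) (by
      rw [lam_sigma_assoc, lam_map, Category.id_comp, Category.comp_id])
  -- The two sides land in the two bracketings of a triple composite, which `comp_assoc` identifies.
  sigma_coassoc f := (F f).hom_ext
    ((isLiftHom_sigma F f).comp ((isLiftHom_map F _ _ _).vcomp (isLiftHom_sigma F f)))
    ((isLiftHom_sigma F f).comp ((((isLiftHom_sigma F (F f).lam).vcomp (IsLiftHom.id _)).comp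
      (IsLiftHom.comp_assoc _ _ _)).congr (Category.comp_id _) rfl)) (by simp) (by
      rw [lam_sigma_assoc, lam_map, Category.id_comp, lam_sigma_assoc, lam_sigma])
  pi_unit {X Y} f := (F f).hom_ext ((isLiftHom_map F _ _ _).comp (isLiftHom_pi F f))
    (IsLiftHom.id _) (Category.comp_id _) (by
      rw [lam_map_assoc, lam_pi])
  pi_assoc {X Y} f := (F (F (F f).rho).rho).hom_ext
    ((isLiftHom_map F _ _ _).comp (isLiftHom_pi F f))
    ((isLiftHom_pi F (F f).rho).comp (isLiftHom_pi F f)) rfl (by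
      rw [lam_map_assoc, lam_pi, lam_pi_assoc, Category.comp_id])
  distrib {X Y} f := (F (F f).rho).hom_ext
    ((isLiftHom_pi F f).comp (isLiftHom_sigma F f))
    ((isLiftHom_sigma F (F f).rho).comp
      (((isLiftHom_map F (sigma F f) (pi F f) _).comp (isLiftHom_pi F (F f).lam)).vcomp
        ((isLiftHom_pi F f).congr (Category.comp_id _).symm rfl))) (by simp) (by
      rw [lam_pi_assoc, lam_sigma_assoc, lam_map_assoc, lam_pi, Category.comp_id])

end FreeFactorisation

end FreeRealisation

/-! ### Free liftings in an arbitrary realisation -/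

section General

variable {C : Type u} [Category.{v} C] {J : MorphismProperty C}
  {W₁ W₂ W₁' W₂' W₁'' W₂'' : MorphismProperty C}

namespace Realisation

lemma map_congr (N : Realisation W₁ W₂) {X Y X' Y' : C} {f : X ⟶ Y} {g : X' ⟶ Y'}
    {h h' : X ⟶ X'} {k k' : Y ⟶ Y'} (w : h ≫ g = f ≫ k) (hh : h = h') (hk : k = k') :
    N.map h k w = N.map h' k' (by rw [← hh, ← hk, w]) := by
  subst hh hk
  rfl

lemma map_map (N : Realisation W₁ W₂) {X Y X' Y' X'' Y'' : C} {f : X ⟶ Y} {g : X' ⟶ Y'}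
    {l : X'' ⟶ Y''} (h : X ⟶ X') (k : Y ⟶ Y') (h' : X' ⟶ X'') (k' : Y' ⟶ Y'')
    (w : h ≫ g = f ≫ k) (w' : h' ≫ l = g ≫ k') :
    N.map h k w ≫ N.map h' k' w' = N.map (h ≫ h') (k ≫ k') (by
      rw [Category.assoc, w', ← Category.assoc, w, Category.assoc]) :=
  (N.map_comp _ _ _ _ _ _ _).symm

lemma map_map_assoc (N : Realisation W₁ W₂) {X Y X' Y' X'' Y'' Z : C} {f : X ⟶ Y}
    {g : X' ⟶ Y'} {l : X'' ⟶ Y''} (h : X ⟶ X') (k : Y ⟶ Y') (h' : X' ⟶ X'') (k' : Y' ⟶ Y'')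
    (w : h ≫ g = f ≫ k) (w' : h' ≫ l = g ≫ k') (z : N.P l ⟶ Z) :
    N.map h k w ≫ N.map h' k' w' ≫ z = N.map (h ≫ h') (k ≫ k') (by
      rw [Category.assoc, w', ← Category.assoc, w, Category.assoc]) ≫ z := by
  rw [← Category.assoc, map_map]

variable (N : Realisation W₁ W₂) (s : N.Coalgs J)

lemma isLiftHom_map {X Y X' Y' : C} {f : X ⟶ Y} {g : X' ⟶ Y'} (h : X ⟶ X') (k : Y ⟶ Y')
    (w : h ≫ g = f ≫ k) :
    IsLiftHom (N.freeLiftings s f) (N.freeLiftings s g) (N.map h k w) k where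
  w := N.map_rho h k w
  lift_comp A B j hj a b e := by
    simp only [freeLiftings, Category.assoc]
    rw [N.pi_naturality h k w, map_map_assoc]

lemma isLiftHom_pi {X Y : C} (f : X ⟶ Y) :
    IsLiftHom (N.freeLiftings s (N.rho f)) (N.freeLiftings s f) (N.pi f) (𝟙 Y) where
  w := (N.pi_rho f).trans (Category.comp_id _).symm
  lift_comp A B j hj a b e := by
    simp only [freeLiftings, Category.assoc]
    rw [← N.pi_assoc, map_map_assoc]

/-- The distributive law moves `sigma` past `pi`, and coassociativity of the coalgebra on `j` turns
the resulting `sigma j` into the nested lifting of the composite. -/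
lemma isLiftHom_sigma {X Y : C} (f : X ⟶ Y) :
    IsLiftHom (N.freeLiftings s f) ((N.freeLiftings s (N.lam f)).comp (N.freeLiftings s f))
      (N.sigma f) (𝟙 Y) where
  w := by rw [← Category.assoc, N.sigma_rho, Category.id_comp, Category.comp_id]
  lift_comp A B j hj a b e := by
    have hin : (s j hj).s ≫ N.map a b e ≫ N.pi f = (N.freeLiftings s f).lift j hj
        ((a ≫ N.sigma f) ≫ N.rho (N.lam f)) (b ≫ 𝟙 Y) (by
          rw [Category.assoc a, N.sigma_rho, Category.comp_id, Category.comp_id, e]) :=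
      (N.freeLiftings s f).lift_congr j hj e
        (by rw [Category.assoc, N.sigma_rho, Category.comp_id]) (Category.comp_id b).symm
    have hw : (a ≫ N.sigma f) ≫ N.rho (N.lam f) = j ≫ (s j hj).s ≫ N.map a b e ≫ N.pi f := by
      rw [hin, (N.freeLiftings s f).fac_left]
    refine Eq.trans ?_ ((N.freeLiftings s (N.lam f)).lift_congr j hj hw rfl hin)
    change ((s j hj).s ≫ N.map a b e ≫ N.pi f) ≫ N.sigma f =
      (s j hj).s ≫ N.map (a ≫ N.sigma f) ((s j hj).s ≫ N.map a b e ≫ N.pi f) hw ≫ N.pi (N.lam f)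
    rw [Category.assoc, Category.assoc, N.distrib, ← Category.assoc (N.map a b e),
      N.sigma_naturality a b e, Category.assoc,
      ← Category.assoc (s j hj).s, ← (s j hj).s_coassoc, Category.assoc, map_map_assoc,
      map_map_assoc]
    congr 2
    refine N.map_congr _ ?_ ?_
    · rw [Category.id_comp]
    · rw [Category.assoc]

/-- By the unit law for `pi`, the coalgebra structures are recovered from the liftings. -/
lemma s_freeLiftings {A B : C} (j : A ⟶ B) (hj : J j) :
    (N.freeLiftings s j).lift j hj (N.lam j) (𝟙 B) ((N.fac j).trans (Category.comp_id j).symm) =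
      (s j hj).s := by
  simp only [freeLiftings]
  rw [N.pi_unit, Category.comp_id]

/-- A morphism of realisations which preserves the distinguished coalgebras commutes with the
induced choices of liftings. -/
lemma Hom.isLiftHom {N : Realisation W₁ W₂} {N' : Realisation W₁' W₂'} (m : N.Hom N') (s : N.Coalgs J)
    (s' : N'.Coalgs J)
    (hm : ∀ ⦃A B : C⦄ (j : A ⟶ B) (hj : J j), (s j hj).s ≫ m.app j = (s' j hj).s)
    {X Y : C} (f : X ⟶ Y) :
    IsLiftHom (N.freeLiftings s f) (N'.freeLiftings s' f) (m.app f) (𝟙 Y) where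
  w := (m.app_rho f).trans (Category.comp_id _).symm
  lift_comp A B j hj a b e := by
    simp only [freeLiftings, Category.assoc]
    rw [m.pi_app, ← Category.assoc (N.map a b e), m.naturality, Category.assoc,
      ← Category.assoc (s j hj).s, hm, map_map_assoc]

/-- The identity morphism. -/
def Hom.id : N.Hom N where
  app f := 𝟙 _
  naturality h k w := by rw [Category.comp_id, Category.id_comp]
  lam_app f := Category.comp_id _
  app_rho f := Category.id_comp _
  sigma_app f := by rw [N.map_id, Category.comp_id, Category.comp_id, Category.id_comp]
  pi_app f := by rw [N.map_id, Category.id_comp, Category.id_comp, Category.comp_id]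

/-- Composition of morphisms of realisations. -/
def Hom.comp {N : Realisation W₁ W₂} {N' : Realisation W₁' W₂'} {N'' : Realisation W₁'' W₂''} (m : N.Hom N')
    (m' : N'.Hom N'') : N.Hom N'' where
  app f := m.app f ≫ m'.app f
  naturality h k w := by
    rw [← Category.assoc, m.naturality, Category.assoc, m'.naturality, Category.assoc]
  lam_app f := by rw [← Category.assoc, m.lam_app, m'.lam_app]
  app_rho f := by rw [Category.assoc, m'.app_rho, m.app_rho]
  sigma_app f := by
    refine Eq.trans ?_ (Category.assoc _ _ _).symm
    rw [← m'.sigma_app, ← Category.assoc (m.app f), ← m.sigma_app]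
    simp only [Category.assoc]
    congr 2
    rw [← Category.assoc (N'.map _ _ _), m'.naturality]
    refine Eq.trans ?_ (Category.assoc _ _ _).symm
    rw [map_map]
    congr 1
    exact N''.map_congr _ (Category.comp_id _).symm rfl
  pi_app f := by
    rw [← Category.assoc, m.pi_app]
    simp only [Category.assoc]
    rw [m'.pi_app, ← Category.assoc (N'.map _ _ _), m'.naturality, Category.assoc]
    congr 2
    rw [map_map_assoc]
    congr 1
    exact N''.map_congr _ rfl (Category.comp_id _)

/-- The underlying natural weak factorisation system of a realisation. -/
def toNWFS : NWFS C where
  P f := N.P f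
  map h k w := N.map h k w
  lam f := N.lam f
  rho f := N.rho f
  sigma f := N.sigma f
  pi f := N.pi f
  fac f := N.fac f
  lam_mem _ := trivial
  rho_mem _ := trivial
  lam_map h k w := N.lam_map h k w
  map_rho h k w := N.map_rho h k w
  lam_sigma f := N.lam_sigma f
  sigma_rho f := N.sigma_rho f
  lam_pi f := N.lam_pi f
  pi_rho f := N.pi_rho f
  map_id f w := N.map_id f w
  map_comp h k h' k' w w' w'' := N.map_comp h k h' k' w w' w''
  sigma_naturality h k w := N.sigma_naturality h k w
  pi_naturality h k w := N.pi_naturality h k w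
  sigma_counit f := N.sigma_counit f
  sigma_coassoc f := N.sigma_coassoc f
  pi_unit f := N.pi_unit f
  pi_assoc f := N.pi_assoc f
  distrib f := N.distrib f

/-- The canonical morphism from the underlying natural weak factorisation system. -/
def fromNWFS : N.toNWFS.Hom N where
  app _ := 𝟙 _
  naturality h k w := (Hom.id N).naturality h k w
  lam_app f := (Hom.id N).lam_app f
  app_rho f := (Hom.id N).app_rho f
  sigma_app f := (Hom.id N).sigma_app f
  pi_app f := (Hom.id N).pi_app f

/-- The canonical morphism to the underlying natural weak factorisation system. -/
def homToNWFS : N.Hom N.toNWFS where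
  app _ := 𝟙 _
  naturality h k w := (Hom.id N).naturality h k w
  lam_app f := (Hom.id N).lam_app f
  app_rho f := (Hom.id N).app_rho f
  sigma_app f := (Hom.id N).sigma_app f
  pi_app f := (Hom.id N).pi_app f

/-- Distinguished coalgebras for the underlying natural weak factorisation system. -/
def coalgsToNWFS : N.toNWFS.Coalgs J := fun _ _ j hj ↦
  ⟨(s j hj).s, (s j hj).hom_s, (s j hj).s_counit, (s j hj).s_coassoc⟩

variable {N s} in
/-- Every endomorphism of a universal realisation which preserves the distinguished coalgebras is
the identity. -/
lemma IsUniversal.app_eq_id (hN : N.IsUniversal s) (m : N.Hom N)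
    (hm : ∀ ⦃A B : C⦄ (j : A ⟶ B) (hj : J j), (s j hj).s ≫ m.app j = (s j hj).s) {X Y : C}
    (f : X ⟶ Y) : m.app f = 𝟙 _ := by
  -- Universality quantifies over `NWFS` only, so the endomorphism is compared with the identity
  -- inside `N.toNWFS`.
  have h := (hN N.toNWFS (N.coalgsToNWFS s)).unique (y₁ := m.comp N.homToNWFS)
    (y₂ := N.homToNWFS)
    (fun A B j hj ↦ (congrArg ((s j hj).s ≫ ·) (Category.comp_id (m.app j))).trans (hm j hj))
    (fun A B j hj ↦ Category.comp_id _)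
  have h' : (m.comp N.homToNWFS).app f = N.homToNWFS.app f := by rw [h]
  exact (Category.comp_id _).symm.trans h'

end Realisation

end General

/-! ### Universality and the cofibrant replacement comonad -/

section Universal

variable {C : Type u} [Category.{v} C] {J : MorphismProperty C} {W₁ W₂ : MorphismProperty C}

namespace FreeFactorisation

variable (F : ∀ {X Y : C} (f : X ⟶ Y), FreeFactorisation J f) [HasPullbacks C]

/-- The canonical lifting of a map of `J` against the second map of its free factorisation. -/
noncomputable def filler {A B : C} (j : A ⟶ B) (hj : J j) : B ⟶ (F j).obj :=
  (F j).φ.lift j hj (F j).lam (𝟙 B) (by rw [(F j).fac, Category.comp_id])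

omit [HasPullbacks C] in
lemma comp_filler {A B : C} (j : A ⟶ B) (hj : J j) : j ≫ filler F j hj = (F j).lam :=
  (F j).φ.fac_left _ _ _ _ _

-- The filler is a lifting, and `P(1, filler)` and `sigma` respect liftings; both sides are
-- therefore the composite's or the target's lifting of one and the same square.
omit [HasPullbacks C] in
lemma filler_coassoc {A B : C} (j : A ⟶ B) (hj : J j) :
    filler F j hj ≫ map F (𝟙 A) (filler F j hj)
        ((Category.id_comp _).trans (comp_filler F j hj).symm) =
      filler F j hj ≫ sigma F j := by
  have h₁ := (isLiftHom_map F (𝟙 A) (filler F j hj) ((Category.id_comp _).trans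
    (comp_filler F j hj).symm)).lift_comp j hj (F j).lam (𝟙 B)
      (by rw [(F j).fac, Category.comp_id])
  have h₂ := (isLiftHom_sigma F j).lift_comp j hj (F j).lam (𝟙 B)
    (by rw [(F j).fac, Category.comp_id])
  refine h₁.trans (Eq.trans ?_ h₂.symm)
  refine (F (F j).lam).φ.lift_congr j hj _ ?_ ?_
  · rw [lam_map, Category.id_comp, lam_sigma]
  · rw [Category.id_comp]
    refine (F j).φ.lift_congr j hj _ ?_ (Category.comp_id _).symm
    rw [lam_sigma, (F (F j).lam).fac]

/-- The canonical coalgebra structures on the maps of `J`. -/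
noncomputable def coalgs : (realisation F).Coalgs J := fun _ _ j hj ↦
  { s := filler F j hj
    hom_s := comp_filler F j hj
    s_counit := (F j).φ.fac_right _ _ _ _ _
    s_coassoc := filler_coassoc F j hj }

/-- `P(h, k)` followed by `pi` respects liftings, so it carries the filler of `j` to the lifting of
`(h, k)`. Hence morphisms preserving coalgebras respect the original liftings `φ`. -/
lemma freeLiftings_realisation {X Y : C} (f : X ⟶ Y) :
    (realisation F).freeLiftings (coalgs F) f = (F f).φ := by
  ext A B j hj h k w
  change (F j).φ.lift j hj (F j).lam (𝟙 B) _ ≫ map F h k w ≫ pi F f = _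
  rw [((isLiftHom_map F h k w).comp (isLiftHom_pi F f)).lift_comp]
  refine (F f).φ.lift_congr j hj _ ?_ ?_
  · exact (lam_map_assoc F h k w (pi F f)).trans
      ((congrArg (h ≫ ·) (lam_pi F f)).trans (Category.comp_id h))
  · rw [Category.id_comp, Category.comp_id]

/-- The comparison from free factorisations to any realisation with coalgebra structures on the
maps of `J`. -/
noncomputable def comparison (N : Realisation W₁ W₂) (s : N.Coalgs J) {X Y : C} (f : X ⟶ Y) :
    (F f).obj ⟶ N.P f :=
  (F f).desc (N.freeLiftings s f) (N.lam f) (𝟙 Y) (by rw [N.fac, Category.comp_id])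

omit [HasPullbacks C] in
lemma lam_comparison (N : Realisation W₁ W₂) (s : N.Coalgs J) {X Y : C} (f : X ⟶ Y) :
    (F f).lam ≫ comparison F N s f = N.lam f :=
  lam_desc _ _ _ _ _

omit [HasPullbacks C] in
lemma isLiftHom_comparison (N : Realisation W₁ W₂) (s : N.Coalgs J) {X Y : C} (f : X ⟶ Y) :
    IsLiftHom (F f).φ (N.freeLiftings s f) (comparison F N s f) (𝟙 Y) :=
  isLiftHom_desc _ _ _ _ _

omit [HasPullbacks C] in
lemma lam_comparison_assoc (N : Realisation W₁ W₂) (s : N.Coalgs J) {X Y Z : C} (f : X ⟶ Y)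
    (z : N.P f ⟶ Z) : (F f).lam ≫ comparison F N s f ≫ z = N.lam f ≫ z := by
  rw [← Category.assoc, lam_comparison]

omit [HasPullbacks C] in
lemma comparison_rho (N : Realisation W₁ W₂) (s : N.Coalgs J) {X Y : C} (f : X ⟶ Y) :
    comparison F N s f ≫ N.rho f = (F f).rho :=
  (isLiftHom_comparison F N s f).w.trans (Category.comp_id _)

omit [HasPullbacks C] in
lemma map_comparison (N : Realisation W₁ W₂) (s : N.Coalgs J) {X Y X' Y' : C} {f : X ⟶ Y}
    {g : X' ⟶ Y'} (h : X ⟶ X') (k : Y ⟶ Y') (w : h ≫ g = f ≫ k) :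
    map F h k w ≫ comparison F N s g = comparison F N s f ≫ N.map h k w :=
  (F f).hom_ext ((isLiftHom_map F h k w).comp (isLiftHom_comparison F N s g))
    ((isLiftHom_comparison F N s f).comp (N.isLiftHom_map s h k w)) (by simp) (by
      rw [lam_map_assoc, lam_comparison, lam_comparison_assoc, N.lam_map])

omit [HasPullbacks C] in
lemma sigma_comparison (N : Realisation W₁ W₂) (s : N.Coalgs J) {X Y : C} (f : X ⟶ Y) :
    sigma F f ≫ comparison F N s (F f).lam ≫ N.map (𝟙 X) (comparison F N s f)
        ((Category.id_comp _).trans (lam_comparison F N s f).symm) =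
      comparison F N s f ≫ N.sigma f :=
  (F f).hom_ext
    ((isLiftHom_sigma F f).comp (((isLiftHom_comparison F N s (F f).lam).comp
      ((N.isLiftHom_map s (𝟙 X) (comparison F N s f) _))).vcomp
        ((isLiftHom_comparison F N s f).congr (Category.id_comp _).symm rfl)))
    ((isLiftHom_comparison F N s f).comp (N.isLiftHom_sigma s f)) rfl (by
      rw [lam_sigma_assoc, lam_comparison_assoc, N.lam_map, Category.id_comp,
        lam_comparison_assoc, N.lam_sigma])

omit [HasPullbacks C] in
lemma pi_comparison (N : Realisation W₁ W₂) (s : N.Coalgs J) {X Y : C} (f : X ⟶ Y) :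
    pi F f ≫ comparison F N s f =
      comparison F N s (F f).rho ≫ N.map (comparison F N s f) (𝟙 Y)
        ((comparison_rho F N s f).trans (Category.comp_id _).symm) ≫ N.pi f :=
  (F (F f).rho).hom_ext
    ((isLiftHom_pi F f).comp (isLiftHom_comparison F N s f))
    ((isLiftHom_comparison F N s (F f).rho).comp
      ((N.isLiftHom_map s (comparison F N s f) (𝟙 Y) _).comp (N.isLiftHom_pi s f)))
    (by simp) (by
      rw [lam_pi_assoc, lam_comparison_assoc, ← Category.assoc, N.lam_map, Category.assoc,
        N.lam_pi, Category.comp_id])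

/-- The comparison from free factorisations, as a morphism of realisations. -/
noncomputable def comparisonHom (N : Realisation W₁ W₂) (s : N.Coalgs J) :
    (realisation F).Hom N where
  app f := comparison F N s f
  naturality h k w := map_comparison F N s h k w
  lam_app f := lam_comparison F N s f
  app_rho f := comparison_rho F N s f
  sigma_app f := sigma_comparison F N s f
  pi_app f := pi_comparison F N s f

lemma s_comparisonHom (N : Realisation W₁ W₂) (s : N.Coalgs J) {A B : C} (j : A ⟶ B) (hj : J j) :
    (coalgs F j hj).s ≫ (comparisonHom F N s).app j = (s j hj).s := by
  refine ((isLiftHom_comparison F N s j).lift_comp _ _ _ _ _).trans ?_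
  rw [← N.s_freeLiftings s j hj]
  exact Liftings.lift_congr _ _ _ _ (lam_comparison F N s j) (Category.comp_id _)

lemma isUniversal_realisation : (realisation F).IsUniversal (coalgs F) := by
  intro N s
  refine ⟨comparisonHom F N s, fun A B j hj ↦ s_comparisonHom F N s j hj, fun m hm ↦ ?_⟩
  have h {X Y : C} (f : X ⟶ Y) : m.app f = (comparisonHom F N s).app f := by
    have hl := m.isLiftHom (coalgs F) s hm f
    rw [freeLiftings_realisation] at hl
    exact (F f).hom_ext hl (isLiftHom_comparison F N s f) rfl
      ((m.lam_app f).trans (lam_comparison F N s f).symm)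
  cases m
  congr 1
  funext X Y f
  exact h f

end FreeFactorisation

namespace Realisation

variable {N : Realisation W₁ W₂} {s : N.Coalgs J}

open FreeFactorisation in
/-- The factorisations of a universal realisation are free. -/
noncomputable def IsUniversal.freeFactorisation [HasPullbacks C] (hN : N.IsUniversal s)
    (F : ∀ {X Y : C} (f : X ⟶ Y), FreeFactorisation J f) {X Y : C} (f : X ⟶ Y) :
    FreeFactorisation J f where
  obj := N.P f
  lam := N.lam f
  rho := N.rho f
  fac := N.fac f
  φ := N.freeLiftings s f
  existsUnique {Z W g} ψ h k w := by
    let M := FreeFactorisation.realisation F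
    let t : M.Coalgs J := FreeFactorisation.coalgs F
    let c := FreeFactorisation.comparisonHom F N s
    obtain ⟨m₀, hm₀, -⟩ := hN M.toNWFS (M.coalgsToNWFS t)
    let m : N.Hom M := m₀.comp M.fromNWFS
    have hm ⦃A B : C⦄ (j : A ⟶ B) (hj : J j) : (s j hj).s ≫ m.app j = (t j hj).s :=
      (congrArg ((s j hj).s ≫ ·) (Category.comp_id (m₀.app j))).trans (hm₀ j hj)
    -- This retraction suffices: maps out of `N.P f` are determined by their restrictions along `c`,
    -- which freeness of `F f` pins down.
    have hmc : m.app f ≫ c.app f = 𝟙 _ := hN.app_eq_id (m.comp c) (fun A B j hj ↦ by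
      change _ ≫ m.app j ≫ c.app j = _
      rw [← Category.assoc, hm, FreeFactorisation.s_comparisonHom]) f
    have hml : IsLiftHom (N.freeLiftings s f) (F f).φ (m.app f) (𝟙 Y) := by
      have := m.isLiftHom s t hm f
      rwa [FreeFactorisation.freeLiftings_realisation] at this
    let a : N.P f ⟶ (F f).obj := m.app f
    let b : (F f).obj ⟶ N.P f := c.app f
    have ha : N.lam f ≫ a = (F f).lam := m.lam_app f
    have hb : (F f).lam ≫ b = N.lam f := c.lam_app f
    have hab : a ≫ b = 𝟙 _ := hmc
    refine ⟨a ≫ (F f).desc ψ h k w, ⟨?_, ?_⟩, ?_⟩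
    · rw [← Category.assoc, ha, lam_desc]
    · exact (hml.comp ((F f).isLiftHom_desc ψ h k w)).congr rfl (Category.id_comp k)
    · rintro v ⟨hv, hv'⟩
      have : b ≫ v = (F f).desc ψ h k w :=
        (F f).hom_ext ((isLiftHom_comparison F N s f).comp hv')
          ((F f).isLiftHom_desc ψ h k w) (Category.id_comp k) (by
            rw [lam_desc, ← hv, ← Category.assoc, hb])
      rw [← this, ← Category.assoc, hab, Category.id_comp]

/-- The algebraic acyclic fibration `(ε_X, φ_X)` of a universal realisation is initial. -/
lemma IsUniversal.nonempty_isInitial_counitAAF [HasPullbacks C] [HasInitial C]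
    (hN : N.IsUniversal s) (F : ∀ {X Y : C} (f : X ⟶ Y), FreeFactorisation J f) (X : C) :
    Nonempty (IsInitial (N.counitAAF s X)) := by
  let E := hN.freeFactorisation F (initial.to X)
  have hE (G : AAF J X) : initial.to G.dom ≫ G.map = initial.to X ≫ 𝟙 X := initial.hom_ext _ _
  let d (G : AAF J X) : N.counitAAF s X ⟶ G := IsLiftHom.hom (F := N.counitAAF s X)
    (E.isLiftHom_desc G.φ (initial.to G.dom) (𝟙 X) (hE G))
  refine ⟨IsInitial.ofUniqueHom d fun G u ↦ AAF.Hom.ext ?_⟩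
  exact E.hom_ext (IsLiftHom.of_hom u) (E.isLiftHom_desc _ _ _ (hE G)) rfl (initial.hom_ext _ _)

variable (N s) in
/-- The comultiplication of the cofibrant replacement comonad commutes with the choices of
liftings. -/
lemma isLiftHom_cofibrantReplacement_δ [HasInitial C] (X : C) :
    IsLiftHom (N.counitAAF s X).φ (N.counitCompAAF s X).φ (N.cofibrantReplacement.δ.app X)
      (𝟙 X) :=
  -- The factor `P(1, 1)` is the identification of `P (lam (0 ⟶ X))` with `P (0 ⟶ QX)` in the
  -- definition of the comultiplication.
  ((N.isLiftHom_sigma s (initial.to X)).comp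
    ((N.isLiftHom_map s (𝟙 _) (𝟙 (N.P (initial.to X))) (initial.hom_ext _ _)).vcomp
      (IsLiftHom.id (N.freeLiftings s (initial.to X))))).congr rfl (Category.comp_id _)

end Realisation

end Universal

end AlgFact

theorem mainTheorem7 {C : Type u} [Category.{v} C] [IsLocallyFinitelyPresentable.{v} C]
    (J : MorphismProperty C) [MorphismProperty.IsSmall.{v} J] :
    (∃ (N : AlgFact.Realisation J.rlp.llp J.rlp) (s : N.Coalgs J), N.IsUniversal s) ∧
    ∀ (N : AlgFact.Realisation J.rlp.llp J.rlp) (s : N.Coalgs J), N.IsUniversal s → ∀ X : C,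
      Nonempty (IsInitial (N.counitAAF s X)) ∧
      ∃ m : N.counitAAF s X ⟶ N.counitCompAAF s X,
        m.hom = N.cofibrantReplacement.δ.app X ∧
        ∀ m' : N.counitAAF s X ⟶ N.counitCompAAF s X, m' = m := by
  let F {X Y : C} (f : X ⟶ Y) : AlgFact.FreeFactorisation J f :=
    (AlgFact.nonempty_freeFactorisation J f).some
  refine ⟨⟨_, _, AlgFact.FreeFactorisation.isUniversal_realisation F⟩, fun N s hN X ↦ ?_⟩
  obtain ⟨hi⟩ := hN.nonempty_isInitial_counitAAF F X
  exact ⟨⟨hi⟩, (N.isLiftHom_cofibrantReplacement_δ s X).hom, rfl, fun m' ↦ hi.hom_ext _ _⟩
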